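/- **Theorem 3.9.** Let $q\in(0,1)$. Let $U_q\mathfrak{sl}_2$ be the $\mathbb C$-algebra generated by $K,K^{-1},E,F$ with the relations $$KK^{-1}=K^{-1}K=1,\quad K^{\pm1}E=q^{\pm2}EK^{\pm1},\quad K^{\pm1}F=q^{\mp2}FK^{\pm1},\quad EF-FE=\frac{K-K^{-1}}{q-q^{-1}},$$ with the comultiplication $\Delta(K^{\pm1})=K^{\pm1}\otimes K^{\pm1}$, $\Delta(E)=E\otimes1+K\otimes E$, $\Delta(F)=F\otimes K^{-1}+1\otimes F$ and the counit $\varepsilon(K^{\pm1})=1$, $\varepsilon(E)=\varepsilon(F)=0$. Let $\mathrm{Pol}(\mathbb C)_q$ be the unital $\mathbb C$-algebra with generators $z,z^*$ and the relation $z^*z=q^2zz^*+1-q^2$, equipped with the $U_q\mathfrak{sl}_2$-module algebra structure (that is, $\xi\cdot1=\varepsilon(\xi)1$ and the multiplication is a morphism of $U_q\mathfrak{sl}_2$-modules) such that $$K^{\pm1}z=q^{\pm2}z,\quad Fz=q^{1/2},\quad Ez=-q^{1/2}z^2,\qquad K^{\pm1}z^*=q^{\mp2}z^*,\quad Ez^*=q^{-3/2},\quad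 Fz^*=-q^{5/2}z^{*2}.$$ Let $D(U)_q'$ be the $\mathrm{Pol}(\mathbb C)_q$-bimodule of formal series $f=\sum_{j,k\ge0}a_{jk}z^jz^{*k}$, $a_{jk}\in\mathbb C$, with the topology of coefficientwise convergence, in which $\mathrm{Pol}(\mathbb C)_q$ is the dense subspace of finite sums, and extend the $U_q\mathfrak{sl}_2$-action to $D(U)_q'$ by continuity. Let $$D(U)_q=\{f\in D(U)_q' \mid z^{*N}f=fz^N=0 \text{ for some } N\in\mathbb N\},$$ which is a $U_q\mathfrak{sl}_2$-submodule of $D(U)_q'$. Let $T$ be the representation of $\mathrm{Pol}(\mathbb C)_q$ in the space with basis $e_0,e_1,e_2,\dots$ given by $$T(z)e_m=(1-q^{2(m+1)})^{1/2}e_{m+1},\qquad T(z^*)e_m=(1-q^{2m})^{1/2}e_{m-1},\qquad T(z^*)e_0=0,$$ and for $f=\sum a_{jk}z^jz^{*k}\in D(U)_q'$ let $l_{mn}(f)=\sum_{j,k}a_{jk}\,l_{mn}(z^jz^{*k})$, where $l_{mn}(z^jz^{*k})$ is the coefficient of $e_m$ in $T(z^jz^{*k})e_n$ (it vanishes unless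 $j\le m$ and $k\le n$, so the sum is finite). Then there is exactly one $f_0\in D(U)_q$ with $l_{00}(f_0)=1$ and $l_{mn}(f_0)=0$ for $(m,n)\ne(0,0)$, and $f_0$ generates the $U_q\mathfrak{sl}_2$-module $D(U)_q$: $\;U_q\mathfrak{sl}_2\cdot f_0=D(U)_q$. -/

import Mathlib

namespace QDisc

noncomputable section

/-! The deformation parameter is a real number `q` in the interval `(0, 1)`. -/

/-- The parameter `q` as a complex number. -/
def qc (q : Set.Ioo (0 : ℝ) 1) : ℂ := ((q : ℝ) : ℂ)

/-- The positive square root `q ^ (1/2)` as a complex number. -/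
def qh (q : Set.Ioo (0 : ℝ) 1) : ℂ := ((Real.sqrt (q : ℝ) : ℝ) : ℂ)

theorem qc_ne (q : Set.Ioo (0 : ℝ) 1) : qc q ≠ 0 := by
  have := q.2.1
  simp [qc, this.ne']

theorem qh_sq (q : Set.Ioo (0 : ℝ) 1) : qh q ^ 2 = qc q := by
  have := q.2.1.le
  simp only [qh, qc, ← Complex.ofReal_pow, Real.sq_sqrt this]

theorem one_sub_ne (q : Set.Ioo (0 : ℝ) 1) : 1 - qc q ^ 2 ≠ 0 := by
  have h0 := q.2.1
  have h1 := q.2.2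
  have : (1 : ℝ) - (q : ℝ) ^ 2 ≠ 0 := by nlinarith
  simp only [qc]
  exact_mod_cast this

/-! ### The quantum universal enveloping algebra of `sl₂` -/

/-- The four generators of `U_q sl₂`. -/
inductive UGen
  | K | Kinv | E | F

/-- The defining relations of `U_q sl₂`. -/
inductive URel (q : Set.Ioo (0 : ℝ) 1) : FreeAlgebra ℂ UGen → FreeAlgebra ℂ UGen → Prop
  | KKinv : URel q (FreeAlgebra.ι ℂ .K * FreeAlgebra.ι ℂ .Kinv) 1
  | KinvK : URel q (FreeAlgebra.ι ℂ .Kinv * FreeAlgebra.ι ℂ .K) 1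
  | KE : URel q (FreeAlgebra.ι ℂ .K * FreeAlgebra.ι ℂ .E)
      (qc q ^ 2 • (FreeAlgebra.ι ℂ .E * FreeAlgebra.ι ℂ .K))
  | KinvE : URel q (FreeAlgebra.ι ℂ .Kinv * FreeAlgebra.ι ℂ .E)
      ((qc q ^ 2)⁻¹ • (FreeAlgebra.ι ℂ .E * FreeAlgebra.ι ℂ .Kinv))
  | KF : URel q (FreeAlgebra.ι ℂ .K * FreeAlgebra.ι ℂ .F)
      ((qc q ^ 2)⁻¹ • (FreeAlgebra.ι ℂ .F * FreeAlgebra.ι ℂ .K))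
  | KinvF : URel q (FreeAlgebra.ι ℂ .Kinv * FreeAlgebra.ι ℂ .F)
      (qc q ^ 2 • (FreeAlgebra.ι ℂ .F * FreeAlgebra.ι ℂ .Kinv))
  | EF : URel q
      (FreeAlgebra.ι ℂ .E * FreeAlgebra.ι ℂ .F - FreeAlgebra.ι ℂ .F * FreeAlgebra.ι ℂ .E)
      ((qc q - (qc q)⁻¹)⁻¹ • (FreeAlgebra.ι ℂ .K - FreeAlgebra.ι ℂ .Kinv))

/-- The algebra `U_q sl₂` over `ℂ`. -/
def Uq (q : Set.Ioo (0 : ℝ) 1) : Type := RingQuot (URel q)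

instance (q : Set.Ioo (0 : ℝ) 1) : Ring (Uq q) := inferInstanceAs (Ring (RingQuot (URel q)))

instance (q : Set.Ioo (0 : ℝ) 1) : Algebra ℂ (Uq q) :=
  inferInstanceAs (Algebra ℂ (RingQuot (URel q)))

/-- The quotient map from the free algebra onto `U_q sl₂`. -/
def uMk (q : Set.Ioo (0 : ℝ) 1) : FreeAlgebra ℂ UGen →ₐ[ℂ] Uq q := RingQuot.mkAlgHom ℂ (URel q)

/-- The class of a generator in `U_q sl₂`. -/
def ugen (q : Set.Ioo (0 : ℝ) 1) (g : UGen) : Uq q :=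
  uMk q (FreeAlgebra.ι ℂ g)

/-- An algebra map out of `U_q sl₂` given by the images of the generators. -/
def uLift (q : Set.Ioo (0 : ℝ) 1) {A : Type} [Ring A] [Algebra ℂ A] (φ : UGen → A)
    (h : ∀ ⦃x y⦄, URel q x y → FreeAlgebra.lift ℂ φ x = FreeAlgebra.lift ℂ φ y) : Uq q →ₐ[ℂ] A :=
  RingQuot.liftAlgHom ℂ ⟨FreeAlgebra.lift ℂ φ, h⟩

theorem uLift_ugen (q : Set.Ioo (0 : ℝ) 1) {A : Type} [Ring A] [Algebra ℂ A] (φ : UGen → A)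
    (h : ∀ ⦃x y⦄, URel q x y → FreeAlgebra.lift ℂ φ x = FreeAlgebra.lift ℂ φ y) (g : UGen) :
    uLift q φ h (ugen q g) = φ g :=
  (RingQuot.liftAlgHom_mkAlgHom_apply ℂ (FreeAlgebra.lift ℂ φ) h _).trans
    (FreeAlgebra.lift_ι_apply _ _)

theorem u_induction {q : Set.Ioo (0 : ℝ) 1} {P : Uq q → Prop}
    (hc : ∀ c : ℂ, P (algebraMap ℂ (Uq q) c)) (hadd : ∀ a b, P a → P b → P (a + b))
    (hmul : ∀ a b, P a → P b → P (a * b)) (hg : ∀ g, P (ugen q g)) (a : Uq q) : P a := by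
  obtain ⟨x, rfl⟩ : ∃ x, uMk q x = a := RingQuot.mkAlgHom_surjective ℂ (URel q) a
  induction x using FreeAlgebra.induction with
  | grade0 r => rw [AlgHom.commutes]; exact hc r
  | grade1 i => exact hg i
  | mul a b ha hb => rw [map_mul]; exact hmul _ _ ha hb
  | add a b ha hb => rw [map_add]; exact hadd _ _ ha hb

/-! ### The polynomial algebra `Pol(ℂ)_q` -/

/-- The generators `z` and `z*` of `Pol(ℂ)_q`. -/
inductive PolGen
  | z | zs

/-- The defining relation `z* z = q² z z* + 1 - q²`. -/
inductive PolRel (q : Set.Ioo (0 : ℝ) 1) : FreeAlgebra ℂ PolGen → FreeAlgebra ℂ PolGen → Prop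
  | comm : PolRel q (FreeAlgebra.ι ℂ .zs * FreeAlgebra.ι ℂ .z)
      (qc q ^ 2 • (FreeAlgebra.ι ℂ .z * FreeAlgebra.ι ℂ .zs) + (1 - qc q ^ 2) • 1)

/-- The algebra `Pol(ℂ)_q`. -/
def Pol (q : Set.Ioo (0 : ℝ) 1) : Type := RingQuot (PolRel q)

instance (q : Set.Ioo (0 : ℝ) 1) : Ring (Pol q) := inferInstanceAs (Ring (RingQuot (PolRel q)))

instance (q : Set.Ioo (0 : ℝ) 1) : Algebra ℂ (Pol q) :=
  inferInstanceAs (Algebra ℂ (RingQuot (PolRel q)))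

/-- The quotient map from the free algebra onto `Pol(ℂ)_q`. -/
def polMk (q : Set.Ioo (0 : ℝ) 1) : FreeAlgebra ℂ PolGen →ₐ[ℂ] Pol q :=
  RingQuot.mkAlgHom ℂ (PolRel q)

/-- The generator `z`. -/
def z (q : Set.Ioo (0 : ℝ) 1) : Pol q := polMk q (FreeAlgebra.ι ℂ .z)

/-- The generator `z*`. -/
def zs (q : Set.Ioo (0 : ℝ) 1) : Pol q := polMk q (FreeAlgebra.ι ℂ .zs)

theorem zs_mul_z (q : Set.Ioo (0 : ℝ) 1) :
    zs q * z q = qc q ^ 2 • (z q * zs q) + (1 - qc q ^ 2) • 1 := by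
  have h : polMk q _ = polMk q _ := RingQuot.mkAlgHom_rel ℂ (PolRel.comm (q := q))
  simp only [map_mul, map_add, map_smul, map_one] at h
  exact h

/-- An algebra map out of `Pol(ℂ)_q` given by the images of the two generators. -/
def polLift (q : Set.Ioo (0 : ℝ) 1) {A : Type} [Ring A] [Algebra ℂ A] (a b : A)
    (h : b * a = qc q ^ 2 • (a * b) + (1 - qc q ^ 2) • 1) : Pol q →ₐ[ℂ] A :=
  RingQuot.liftAlgHom ℂ ⟨FreeAlgebra.lift ℂ (fun g => PolGen.rec a b g), by
    rintro _ _ ⟨⟩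
    simpa only [map_mul, map_add, map_smul, map_one, FreeAlgebra.lift_ι_apply] using h⟩

theorem polLift_z (q : Set.Ioo (0 : ℝ) 1) {A : Type} [Ring A] [Algebra ℂ A] (a b : A)
    (h : b * a = qc q ^ 2 • (a * b) + (1 - qc q ^ 2) • 1) : polLift q a b h (z q) = a :=
  (RingQuot.liftAlgHom_mkAlgHom_apply ℂ _ _ _).trans (FreeAlgebra.lift_ι_apply _ _)

theorem polLift_zs (q : Set.Ioo (0 : ℝ) 1) {A : Type} [Ring A] [Algebra ℂ A] (a b : A)
    (h : b * a = qc q ^ 2 • (a * b) + (1 - qc q ^ 2) • 1) : polLift q a b h (zs q) = b :=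
  (RingQuot.liftAlgHom_mkAlgHom_apply ℂ _ _ _).trans (FreeAlgebra.lift_ι_apply _ _)

theorem pol_induction {q : Set.Ioo (0 : ℝ) 1} {P : Pol q → Prop}
    (h1 : P 1) (hadd : ∀ f g, P f → P g → P (f + g)) (hsmul : ∀ (c : ℂ) f, P f → P (c • f))
    (hz : ∀ f, P f → P (z q * f)) (hzs : ∀ f, P f → P (zs q * f)) (f : Pol q) : P f := by
  obtain ⟨x, rfl⟩ : ∃ x, polMk q x = f := RingQuot.mkAlgHom_surjective ℂ (PolRel q) f
  have key : ∀ g, P g → P (polMk q x * g) := by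
    induction x using FreeAlgebra.induction with
    | grade0 r =>
      intro g hg
      rw [AlgHom.commutes, ← Algebra.smul_def]
      exact hsmul r g hg
    | grade1 i =>
      intro g hg
      cases i
      · exact hz g hg
      · exact hzs g hg
    | mul a b ha hb =>
      intro g hg
      rw [map_mul, mul_assoc]
      exact ha _ (hb _ hg)
    | add a b ha hb =>
      intro g hg
      rw [map_add, add_mul]
      exact hadd _ _ (ha _ hg) (hb _ hg)
  simpa using key 1 h1

/-! ### The covariant action of `U_q sl₂` on `Pol(ℂ)_q`

The comultiplication is `Δ(K^{±1}) = K^{±1} ⊗ K^{±1}`, `Δ(E) = E ⊗ 1 + K ⊗ E` and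
`Δ(F) = F ⊗ K⁻¹ + 1 ⊗ F`.  Hence, in a covariant algebra, `K^{±1}` act by algebra endomorphisms and
`E (f g) = E f * g + K f * E g`, `F (f g) = F f * K⁻¹ g + f * F g`.  The last two rules say that
`f ↦ !![K f, E f; 0, f]` and `f ↦ !![f, F f; 0, K⁻¹ f]` are algebra maps, and this is how `E`
and `F` are constructed from their values on the generators:
`K z = q² z`, `K z* = q⁻² z*`, `E z = - q^(1/2) z²`, `E z* = q^(-3/2)`,
`F z = q^(1/2)`, `F z* = - q^(5/2) z*²`. -/

/-- The action of `K`. -/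
def polK (q : Set.Ioo (0 : ℝ) 1) : Pol q →ₐ[ℂ] Pol q :=
  polLift q (qc q ^ 2 • z q) ((qc q ^ 2)⁻¹ • zs q) (by
    have := qc_ne q
    rw [smul_mul_smul_comm, smul_mul_smul_comm, zs_mul_z]
    field_simp
    simp)

/-- The action of `K⁻¹`. -/
def polKinv (q : Set.Ioo (0 : ℝ) 1) : Pol q →ₐ[ℂ] Pol q :=
  polLift q ((qc q ^ 2)⁻¹ • z q) (qc q ^ 2 • zs q) (by
    have := qc_ne q
    rw [smul_mul_smul_comm, smul_mul_smul_comm, zs_mul_z]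
    field_simp
    simp)

@[simp] theorem polK_z (q : Set.Ioo (0 : ℝ) 1) : polK q (z q) = qc q ^ 2 • z q := polLift_z ..
@[simp] theorem polK_zs (q : Set.Ioo (0 : ℝ) 1) : polK q (zs q) = (qc q ^ 2)⁻¹ • zs q :=
  polLift_zs ..
@[simp] theorem polKinv_z (q : Set.Ioo (0 : ℝ) 1) : polKinv q (z q) = (qc q ^ 2)⁻¹ • z q :=
  polLift_z ..
@[simp] theorem polKinv_zs (q : Set.Ioo (0 : ℝ) 1) : polKinv q (zs q) = qc q ^ 2 • zs q :=
  polLift_zs ..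

theorem zs_mul_z_sq (q : Set.Ioo (0 : ℝ) 1) :
    zs q * (z q * z q) = qc q ^ 4 • (z q * (z q * zs q)) + (1 - qc q ^ 4) • z q := by
  rw [← mul_assoc, zs_mul_z, add_mul, smul_mul_assoc, mul_assoc, zs_mul_z]
  simp only [mul_add, smul_add, mul_smul_comm, smul_mul_assoc, mul_one, one_mul]
  module

theorem zs_sq_mul_z (q : Set.Ioo (0 : ℝ) 1) :
    zs q * (zs q * z q) = qc q ^ 4 • (z q * (zs q * zs q)) + (1 - qc q ^ 4) • zs q := by
  rw [zs_mul_z, mul_add, mul_smul_comm, ← mul_assoc, zs_mul_z]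
  simp only [add_mul, smul_add, mul_smul_comm, smul_mul_assoc, mul_one, one_mul, mul_assoc]
  module

/-- The algebra map `f ↦ !![K f, E f; 0, f]`. -/
def polEMat (q : Set.Ioo (0 : ℝ) 1) : Pol q →ₐ[ℂ] Matrix (Fin 2) (Fin 2) (Pol q) :=
  polLift q
    !![qc q ^ 2 • z q, -(qh q • (z q * z q)); 0, z q]
    !![(qc q ^ 2)⁻¹ • zs q, (qh q / qc q ^ 2) • 1; 0, zs q] (by
    have := qc_ne q
    ext i j
    fin_cases i <;> fin_cases j
    · simp [Matrix.mul_apply, Fin.sum_univ_two, zs_mul_z, smul_smul, this]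
    · simp [Matrix.mul_apply, Fin.sum_univ_two, zs_mul_z_sq, mul_assoc]
      match_scalars <;> (field_simp; try ring)
    · simp [Matrix.mul_apply, Fin.sum_univ_two]
    · simp [Matrix.mul_apply, Fin.sum_univ_two, zs_mul_z])

/-- The algebra map `f ↦ !![f, F f; 0, K⁻¹ f]`. -/
def polFMat (q : Set.Ioo (0 : ℝ) 1) : Pol q →ₐ[ℂ] Matrix (Fin 2) (Fin 2) (Pol q) :=
  polLift q
    !![z q, qh q • 1; 0, (qc q ^ 2)⁻¹ • z q]
    !![zs q, -((qh q * qc q ^ 2) • (zs q * zs q)); 0, qc q ^ 2 • zs q] (by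
    have := qc_ne q
    ext i j
    fin_cases i <;> fin_cases j
    · simp [Matrix.mul_apply, Fin.sum_univ_two, zs_mul_z]
    · simp [Matrix.mul_apply, Fin.sum_univ_two, zs_sq_mul_z, mul_assoc]
      match_scalars <;> (field_simp; try ring)
    · simp [Matrix.mul_apply, Fin.sum_univ_two]
    · simp [Matrix.mul_apply, Fin.sum_univ_two, zs_mul_z, smul_smul, this])

/-- The action of `E`. -/
def polE (q : Set.Ioo (0 : ℝ) 1) : Pol q →ₗ[ℂ] Pol q :=
  Matrix.entryLinearMap ℂ (Pol q) 0 1 ∘ₗ (polEMat q).toLinearMap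

/-- The action of `F`. -/
def polF (q : Set.Ioo (0 : ℝ) 1) : Pol q →ₗ[ℂ] Pol q :=
  Matrix.entryLinearMap ℂ (Pol q) 0 1 ∘ₗ (polFMat q).toLinearMap

@[simp] theorem polE_one (q : Set.Ioo (0 : ℝ) 1) : polE q 1 = 0 := by
  simp [polE]

@[simp] theorem polF_one (q : Set.Ioo (0 : ℝ) 1) : polF q 1 = 0 := by
  simp [polF]

@[simp] theorem polE_z (q : Set.Ioo (0 : ℝ) 1) : polE q (z q) = -(qh q • (z q * z q)) := by
  simp [polE, polEMat, polLift_z]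

/- Here `q^(1/2) / q² = q^(-3/2)`. -/
@[simp] theorem polE_zs (q : Set.Ioo (0 : ℝ) 1) : polE q (zs q) = (qh q / qc q ^ 2) • 1 := by
  simp [polE, polEMat, polLift_zs]

@[simp] theorem polF_z (q : Set.Ioo (0 : ℝ) 1) : polF q (z q) = qh q • 1 := by
  simp [polF, polFMat, polLift_z]

/- Here `q^(1/2) q² = q^(5/2)`. -/
@[simp] theorem polF_zs (q : Set.Ioo (0 : ℝ) 1) :
    polF q (zs q) = -((qh q * qc q ^ 2) • (zs q * zs q)) := by
  simp [polF, polFMat, polLift_zs]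

theorem polEMat_z (q : Set.Ioo (0 : ℝ) 1) :
    polEMat q (z q) = !![qc q ^ 2 • z q, -(qh q • (z q * z q)); 0, z q] := polLift_z ..

theorem polEMat_zs (q : Set.Ioo (0 : ℝ) 1) :
    polEMat q (zs q) = !![(qc q ^ 2)⁻¹ • zs q, (qh q / qc q ^ 2) • 1; 0, zs q] := polLift_zs ..

theorem polEMat_eq (q : Set.Ioo (0 : ℝ) 1) (f : Pol q) :
    polEMat q f = !![polK q f, polE q f; 0, f] := by
  have h : polEMat q f 0 0 = polK q f ∧ polEMat q f 1 0 = 0 ∧ polEMat q f 1 1 = f := by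
    induction f using pol_induction with
    | h1 => simp
    | hadd f g hf hg => simp [hf, hg]
    | hsmul c f hf => simp [hf]
    | hz f hf => simp [Matrix.mul_apply, hf, polEMat_z]
    | hzs f hf => simp [Matrix.mul_apply, hf, polEMat_zs]
  ext i j
  fin_cases i <;> fin_cases j <;> simp [h, polE]

theorem polFMat_z (q : Set.Ioo (0 : ℝ) 1) :
    polFMat q (z q) = !![z q, qh q • 1; 0, (qc q ^ 2)⁻¹ • z q] := polLift_z ..

theorem polFMat_zs (q : Set.Ioo (0 : ℝ) 1) :
    polFMat q (zs q) = !![zs q, -((qh q * qc q ^ 2) • (zs q * zs q)); 0, qc q ^ 2 • zs q] := polLift_zs ..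

theorem polFMat_eq (q : Set.Ioo (0 : ℝ) 1) (f : Pol q) :
    polFMat q f = !![f, polF q f; 0, polKinv q f] := by
  have h : polFMat q f 0 0 = f ∧ polFMat q f 1 0 = 0 ∧ polFMat q f 1 1 = polKinv q f := by
    induction f using pol_induction with
    | h1 => simp
    | hadd f g hf hg => simp [hf, hg]
    | hsmul c f hf => simp [hf]
    | hz f hf => simp [Matrix.mul_apply, hf, polFMat_z]
    | hzs f hf => simp [Matrix.mul_apply, hf, polFMat_zs]
  ext i j
  fin_cases i <;> fin_cases j <;> simp [h, polF]

/-- Covariance for `Δ(E) = E ⊗ 1 + K ⊗ E`. -/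
theorem polE_mul (q : Set.Ioo (0 : ℝ) 1) (f g : Pol q) :
    polE q (f * g) = polE q f * g + polK q f * polE q g := by
  have h : polEMat q (f * g) 0 1 = (polEMat q f * polEMat q g) 0 1 := by rw [map_mul]
  rw [polEMat_eq, polEMat_eq, polEMat_eq] at h
  simpa [Matrix.mul_apply, Fin.sum_univ_two, add_comm] using h

/-- Covariance for `Δ(F) = F ⊗ K⁻¹ + 1 ⊗ F`. -/
theorem polF_mul (q : Set.Ioo (0 : ℝ) 1) (f g : Pol q) :
    polF q (f * g) = polF q f * polKinv q g + f * polF q g := by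
  have h : polFMat q (f * g) 0 1 = (polFMat q f * polFMat q g) 0 1 := by rw [map_mul]
  rw [polFMat_eq, polFMat_eq, polFMat_eq] at h
  simpa [Matrix.mul_apply, Fin.sum_univ_two, add_comm] using h


/-! These operators satisfy the relations of `U_q sl₂`. -/

theorem polKinv_polK (q : Set.Ioo (0 : ℝ) 1) (f : Pol q) : polKinv q (polK q f) = f := by
  have := qc_ne q
  induction f using pol_induction with
  | h1 => simp
  | hadd f g hf hg => simp [hf, hg]
  | hsmul c f hf => simp [hf]
  | hz f hf => simp [hf, smul_smul, this]
  | hzs f hf => simp [hf, smul_smul, this]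

theorem polK_polKinv (q : Set.Ioo (0 : ℝ) 1) (f : Pol q) : polK q (polKinv q f) = f := by
  have := qc_ne q
  induction f using pol_induction with
  | h1 => simp
  | hadd f g hf hg => simp [hf, hg]
  | hsmul c f hf => simp [hf]
  | hz f hf => simp [hf, smul_smul, this]
  | hzs f hf => simp [hf, smul_smul, this]

theorem polK_polE (q : Set.Ioo (0 : ℝ) 1) (f : Pol q) :
    polK q (polE q f) = qc q ^ 2 • polE q (polK q f) := by
  have := qc_ne q
  induction f using pol_induction with
  | h1 => simp
  | hadd f g hf hg => simp [hf, hg]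
  | hsmul c f hf => simp only [map_smul, hf]; rw [smul_comm]
  | hz f hf =>
    simp [polE_mul, hf, mul_assoc]
    match_scalars <;> field_simp
  | hzs f hf =>
    simp [polE_mul, hf, mul_assoc]
    match_scalars <;> field_simp

theorem polK_polF (q : Set.Ioo (0 : ℝ) 1) (f : Pol q) :
    polK q (polF q f) = (qc q ^ 2)⁻¹ • polF q (polK q f) := by
  have := qc_ne q
  induction f using pol_induction with
  | h1 => simp
  | hadd f g hf hg => simp [hf, hg]
  | hsmul c f hf => simp only [map_smul, hf]; rw [smul_comm]
  | hz f hf =>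
    simp [polF_mul, hf, mul_assoc, polK_polKinv, polKinv_polK]
    match_scalars <;> field_simp
  | hzs f hf =>
    simp [polF_mul, hf, mul_assoc, polK_polKinv, polKinv_polK]
    match_scalars <;> field_simp

theorem polKinv_polE (q : Set.Ioo (0 : ℝ) 1) (f : Pol q) :
    polKinv q (polE q f) = (qc q ^ 2)⁻¹ • polE q (polKinv q f) := by
  have h := polK_polE q (polKinv q f)
  rw [polK_polKinv] at h
  rw [← polKinv_polK q (polE q (polKinv q f)), h, map_smul, smul_smul,
    inv_mul_cancel₀ (pow_ne_zero 2 (qc_ne q)), one_smul]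

theorem polKinv_polF (q : Set.Ioo (0 : ℝ) 1) (f : Pol q) :
    polKinv q (polF q f) = qc q ^ 2 • polF q (polKinv q f) := by
  have h := polK_polF q (polKinv q f)
  rw [polK_polKinv] at h
  rw [← polKinv_polK q (polF q (polKinv q f)), h, map_smul, smul_smul,
    mul_inv_cancel₀ (pow_ne_zero 2 (qc_ne q)), one_smul]

theorem polE_polF (q : Set.Ioo (0 : ℝ) 1) (f : Pol q) :
    polE q (polF q f) - polF q (polE q f) =
      (qc q - (qc q)⁻¹)⁻¹ • (polK q f - polKinv q f) := by
  have h0 := qc_ne q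
  have h1 := one_sub_ne q
  have h2 : qc q ^ 2 - 1 ≠ 0 := fun h => h1 (by linear_combination -h)
  have h3 : qc q - (qc q)⁻¹ ≠ 0 := by
    intro h
    apply h2
    field_simp at h
    simpa using h
  have hs := qh_sq q
  induction f using pol_induction with
  | h1 => simp
  | hadd f g hf hg =>
    simp only [map_add]
    rw [add_sub_add_comm, hf, hg]
    module
  | hsmul c f hf =>
    simp only [map_smul]
    rw [← smul_sub, hf]
    module
  | hz f hf =>
    rw [sub_eq_iff_eq_add] at hf
    simp [polE_mul, polF_mul, hf, mul_assoc, mul_add, mul_sub, polKinv_polE]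
    match_scalars <;> field_simp <;>
      first
        | ring1
        | linear_combination (qc q ^ 4 - 1) * hs
        | linear_combination (1 - qc q ^ 4) * hs
  | hzs f hf =>
    rw [sub_eq_iff_eq_add] at hf
    simp [polE_mul, polF_mul, hf, mul_assoc, mul_add, mul_sub, polKinv_polE]
    match_scalars <;> field_simp <;>
      first
        | ring1
        | linear_combination (qc q ^ 4 - 1) * hs
        | linear_combination (1 - qc q ^ 4) * hs

/-- The action of a generator of `U_q sl₂` on `Pol(ℂ)_q`. -/
def polGen (q : Set.Ioo (0 : ℝ) 1) : UGen → Module.End ℂ (Pol q)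
  | .K => (polK q).toLinearMap
  | .Kinv => (polKinv q).toLinearMap
  | .E => polE q
  | .F => polF q

/-- The covariant action of `U_q sl₂` on `Pol(ℂ)_q`. -/
def polAct (q : Set.Ioo (0 : ℝ) 1) : Uq q →ₐ[ℂ] Module.End ℂ (Pol q) :=
  uLift q (polGen q) (by
    rintro _ _ ⟨⟩ <;> ext f <;>
      simp only [map_mul, map_sub, map_smul, map_one, FreeAlgebra.lift_ι_apply, polGen,
        Module.End.mul_apply, Module.End.one_apply, LinearMap.sub_apply, LinearMap.smul_apply,
        AlgHom.toLinearMap_apply]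
    · exact polK_polKinv q f
    · exact polKinv_polK q f
    · exact polK_polE q f
    · exact polKinv_polE q f
    · exact polK_polF q f
    · exact polKinv_polF q f
    · exact polE_polF q f)

@[simp] theorem polAct_ugen (q : Set.Ioo (0 : ℝ) 1) (g : UGen) :
    polAct q (ugen q g) = polGen q g :=
  uLift_ugen ..

/-! ### Distributions: formal series `∑ a_{jk} z^j z*^k` -/

/-- The space `D(U)_q'` of formal series `∑ a_{jk} z^j z*^k`, given by the coefficients `a_{jk}`,
with the topology of coefficientwise convergence. -/
def Distr (_q : Set.Ioo (0 : ℝ) 1) : Type := ℕ × ℕ → ℂ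

section
variable (q : Set.Ioo (0 : ℝ) 1)

instance : AddCommGroup (Distr q) := inferInstanceAs (AddCommGroup (ℕ × ℕ → ℂ))
instance : Module ℂ (Distr q) := inferInstanceAs (Module ℂ (ℕ × ℕ → ℂ))
instance : TopologicalSpace (Distr q) := inferInstanceAs (TopologicalSpace (ℕ × ℕ → ℂ))
instance : IsTopologicalAddGroup (Distr q) :=
  inferInstanceAs (IsTopologicalAddGroup (ℕ × ℕ → ℂ))
instance : ContinuousConstSMul ℂ (Distr q) :=
  inferInstanceAs (ContinuousConstSMul ℂ (ℕ × ℕ → ℂ))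
instance : T2Space (Distr q) := inferInstanceAs (T2Space (ℕ × ℕ → ℂ))

end

/-- The coefficient `a_{jk}` of a formal series. -/
def Distr.coeff {q : Set.Ioo (0 : ℝ) 1} (f : Distr q) (j k : ℕ) : ℂ := f (j, k)

/-- The formal series with given coefficients. -/
def Distr.mk {q : Set.Ioo (0 : ℝ) 1} (a : ℕ → ℕ → ℂ) : Distr q := fun p => a p.1 p.2

/-- The series consisting of the single monomial `z^j z*^k`. -/
def mono (q : Set.Ioo (0 : ℝ) 1) (j k : ℕ) : Distr q :=
  Distr.mk (fun j' k' => if j' = j ∧ k' = k then 1 else 0)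

namespace Distr
variable {q : Set.Ioo (0 : ℝ) 1}

theorem ext' {f g : Distr q} (h : ∀ j k, f.coeff j k = g.coeff j k) : f = g :=
  funext fun p => h p.1 p.2

@[simp] theorem coeff_mk (a : ℕ → ℕ → ℂ) (j k : ℕ) : (Distr.mk a : Distr q).coeff j k = a j k := rfl
@[simp] theorem coeff_add (f g : Distr q) (j k : ℕ) :
    (f + g).coeff j k = f.coeff j k + g.coeff j k := rfl
@[simp] theorem coeff_sub (f g : Distr q) (j k : ℕ) :
    (f - g).coeff j k = f.coeff j k - g.coeff j k := rfl
@[simp] theorem coeff_neg (f : Distr q) (j k : ℕ) : (-f).coeff j k = -f.coeff j k := rfl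
@[simp] theorem coeff_zero (j k : ℕ) : (0 : Distr q).coeff j k = 0 := rfl
@[simp] theorem coeff_smul (c : ℂ) (f : Distr q) (j k : ℕ) :
    (c • f).coeff j k = c * f.coeff j k := rfl

theorem continuous_coeff (j k : ℕ) : Continuous (fun f : Distr q => f.coeff j k) :=
  continuous_apply (A := fun _ : ℕ × ℕ => ℂ) (j, k)

/-- A continuous linear operator given by its coefficients. -/
def op (T : Distr q → ℕ → ℕ → ℂ)
    (hadd : ∀ f g j k, T (f + g) j k = T f j k + T g j k)
    (hsmul : ∀ (c : ℂ) f j k, T (c • f) j k = c * T f j k)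
    (hcont : ∀ j k, Continuous (fun f => T f j k)) : Distr q →L[ℂ] Distr q where
  toFun f := Distr.mk (T f)
  map_add' f g := ext' (by simp [hadd])
  map_smul' c f := ext' (by simp [hsmul])
  cont := continuous_pi (fun p => hcont p.1 p.2)

end Distr

/-- Left multiplication by `z`: `z · z^j z*^k = z^(j+1) z*^k`. -/
def leftZ (q : Set.Ioo (0 : ℝ) 1) : Distr q →L[ℂ] Distr q :=
  Distr.op (fun f j k => match j with | 0 => 0 | j + 1 => f.coeff j k)
    (by intro f g j k; cases j <;> simp)
    (by intro c f j k; cases j <;> simp)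
    (by intro j k; cases j <;> simp [Distr.continuous_coeff, continuous_const])

/-- Left multiplication by `z*`:
`z* · z^j z*^k = q^(2j) z^j z*^(k+1) + (1 - q^(2j)) z^(j-1) z*^k`. -/
def leftZs (q : Set.Ioo (0 : ℝ) 1) : Distr q →L[ℂ] Distr q :=
  Distr.op
    (fun f j k => (match k with | 0 => 0 | k + 1 => qc q ^ (2 * j) * f.coeff j k) +
      (1 - qc q ^ (2 * (j + 1))) * f.coeff (j + 1) k)
    (by intro f g j k; cases k <;> simp <;> ring)
    (by intro c f j k; cases k <;> simp <;> ring)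
    (by
      intro j k
      have := Distr.continuous_coeff (q := q)
      cases k <;> dsimp only <;> fun_prop)

/-- Right multiplication by `z`:
`z^j z*^k · z = q^(2k) z^(j+1) z*^k + (1 - q^(2k)) z^j z*^(k-1)`. -/
def rightZ (q : Set.Ioo (0 : ℝ) 1) : Distr q →L[ℂ] Distr q :=
  Distr.op
    (fun f j k => (match j with | 0 => 0 | j + 1 => qc q ^ (2 * k) * f.coeff j k) +
      (1 - qc q ^ (2 * (k + 1))) * f.coeff j (k + 1))
    (by intro f g j k; cases j <;> simp <;> ring)
    (by intro c f j k; cases j <;> simp <;> ring)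
    (by
      intro j k
      have := Distr.continuous_coeff (q := q)
      cases j <;> dsimp only <;> fun_prop)

section
variable {q : Set.Ioo (0 : ℝ) 1} (f : Distr q) (j k : ℕ)

@[simp] theorem leftZ_zero : (leftZ q f).coeff 0 k = 0 := rfl
@[simp] theorem leftZ_succ : (leftZ q f).coeff (j + 1) k = f.coeff j k := rfl
@[simp] theorem leftZs_zero :
    (leftZs q f).coeff j 0 = (1 - qc q ^ (2 * (j + 1))) * f.coeff (j + 1) 0 := zero_add _
@[simp] theorem leftZs_succ : (leftZs q f).coeff j (k + 1) =
    qc q ^ (2 * j) * f.coeff j k + (1 - qc q ^ (2 * (j + 1))) * f.coeff (j + 1) (k + 1) := rfl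
@[simp] theorem rightZ_zero :
    (rightZ q f).coeff 0 k = (1 - qc q ^ (2 * (k + 1))) * f.coeff 0 (k + 1) := zero_add _
@[simp] theorem rightZ_succ : (rightZ q f).coeff (j + 1) k =
    qc q ^ (2 * k) * f.coeff j k + (1 - qc q ^ (2 * (k + 1))) * f.coeff (j + 1) (k + 1) := rfl

theorem leftZs_leftZ : leftZs q (leftZ q f) =
    qc q ^ 2 • leftZ q (leftZs q f) + (1 - qc q ^ 2) • f := by
  apply Distr.ext'
  rintro (_ | j) (_ | k) <;> simp <;> ring

theorem leftZ_rightZ : leftZ q (rightZ q f) = rightZ q (leftZ q f) := by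
  apply Distr.ext'
  rintro (_ | _ | j) (_ | k) <;> simp

theorem leftZs_rightZ : leftZs q (rightZ q f) = rightZ q (leftZs q f) := by
  apply Distr.ext'
  rintro (_ | _ | j) (_ | _ | k) <;> simp <;> ring

end

/-- The left action of `Pol(ℂ)_q` on `D(U)_q'`. -/
def leftMul (q : Set.Ioo (0 : ℝ) 1) : Pol q →ₐ[ℂ] (Distr q →L[ℂ] Distr q) :=
  polLift q (leftZ q) (leftZs q) (by ext1 f; exact leftZs_leftZ f)

/-- The embedding of `Pol(ℂ)_q` into `D(U)_q'` as the finite sums. -/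
def toDistr (q : Set.Ioo (0 : ℝ) 1) : Pol q →ₗ[ℂ] Distr q where
  toFun f := leftMul q f (mono q 0 0)
  map_add' f g := by simp
  map_smul' c f := by simp

theorem toDistr_one (q : Set.Ioo (0 : ℝ) 1) : toDistr q 1 = mono q 0 0 := by simp [toDistr]

theorem toDistr_z_mul (q : Set.Ioo (0 : ℝ) 1) (f : Pol q) :
    toDistr q (z q * f) = leftZ q (toDistr q f) := by
  simp [toDistr, leftMul, polLift_z]

theorem toDistr_zs_mul (q : Set.Ioo (0 : ℝ) 1) (f : Pol q) :
    toDistr q (zs q * f) = leftZs q (toDistr q f) := by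
  simp [toDistr, leftMul, polLift_zs]

theorem toDistr_mul_z (q : Set.Ioo (0 : ℝ) 1) (f : Pol q) :
    toDistr q (f * z q) = rightZ q (toDistr q f) := by
  induction f using pol_induction with
  | h1 =>
    have h := toDistr_z_mul q 1
    rw [mul_one] at h
    rw [one_mul, h, toDistr_one]
    apply Distr.ext'
    rintro (_ | j) (_ | k) <;> simp [mono]
  | hadd f g hf hg => simp [add_mul, hf, hg]
  | hsmul c f hf => simp [hf]
  | hz f hf => rw [mul_assoc, toDistr_z_mul, hf, toDistr_z_mul, leftZ_rightZ]
  | hzs f hf => rw [mul_assoc, toDistr_zs_mul, hf, toDistr_zs_mul, leftZs_rightZ]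

/-- The monomial `z^j z*^k` has the coefficient `1` at `(j, k)` and `0` elsewhere. -/
theorem toDistr_monomial (q : Set.Ioo (0 : ℝ) 1) (j k : ℕ) :
    toDistr q (z q ^ j * zs q ^ k) = mono q j k := by
  induction j with
  | zero =>
    rw [pow_zero, one_mul]
    induction k with
    | zero => simp [toDistr_one]
    | succ k ih =>
      rw [pow_succ', toDistr_zs_mul, ih]
      apply Distr.ext'
      rintro (_ | j) (_ | k) <;> simp [mono]
  | succ j ih =>
    rw [pow_succ', mul_assoc, toDistr_z_mul, ih]
    apply Distr.ext'
    rintro (_ | j) k <;> simp [mono]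

/-- A continuous operator on `D(U)_q'` is determined by its values on `Pol(ℂ)_q`. -/
theorem distr_hom_ext {q : Set.Ioo (0 : ℝ) 1} {A B : Distr q →L[ℂ] Distr q}
    (h : ∀ f, A (toDistr q f) = B (toDistr q f)) : A = B := by
  ext1 f
  have hs : HasSum (fun p : ℕ × ℕ => f.coeff p.1 p.2 • mono q p.1 p.2) f := by
    refine Pi.hasSum.2 fun p => ?_
    have : f p = f.coeff p.1 p.2 • mono q p.1 p.2 p := by
      simp [mono, Distr.mk, Distr.coeff]
    rw [this]
    refine hasSum_single p fun b hb => ?_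
    have hb' : ¬ (p.1 = b.1 ∧ p.2 = b.2) := fun h => hb (Prod.ext h.1.symm h.2.symm)
    change _ * (if p.1 = b.1 ∧ p.2 = b.2 then (1 : ℂ) else 0) = 0
    rw [if_neg hb', mul_zero]
  have hA := A.hasSum hs
  have hB := B.hasSum hs
  refine hA.unique ?_
  convert hB using 2 with p
  rw [map_smul, map_smul, ← toDistr_monomial, h]

/-- The operator `T'` on `D(U)_q'` is the extension by continuity of the operator `T`
on `Pol(ℂ)_q`. -/
def IsExt {q : Set.Ioo (0 : ℝ) 1} (T : Module.End ℂ (Pol q)) (T' : Distr q →L[ℂ] Distr q) : Prop :=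
  ∀ f, T' (toDistr q f) = toDistr q (T f)

theorem IsExt.unique {q : Set.Ioo (0 : ℝ) 1} {T : Module.End ℂ (Pol q)}
    {A B : Distr q →L[ℂ] Distr q} (hA : IsExt T A) (hB : IsExt T B) : A = B :=
  distr_hom_ext fun f => (hA f).trans (hB f).symm

/-! The extensions of the operators `K^{±1}`, `E`, `F` in coordinates, which come from
`K^{±1} (z^j z*^k) = q^{±2(j-k)} z^j z*^k`,
`E (z^j z*^k) = - q^(1/2) [j] z^(j+1) z*^k + q^(2j) q^(1/2) q^(-2k) [k] z^j z*^(k-1)`,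
`F (z^j z*^k) = q^(2k) q^(1/2) q^(2-2j) [j] z^(j-1) z*^k - q^(5/2) [k] z^j z*^(k+1)`
with `[j] = (1 - q^(2j)) / (1 - q²)`. -/

/-- The number `(1 - q^(2j)) / (1 - q²)`. -/
def qnum (q : Set.Ioo (0 : ℝ) 1) (j : ℕ) : ℂ := (1 - qc q ^ (2 * j)) / (1 - qc q ^ 2)

/-- `K` in coordinates. -/
def dK (q : Set.Ioo (0 : ℝ) 1) : Distr q →L[ℂ] Distr q :=
  Distr.op (fun f j k => qc q ^ (2 * j) / qc q ^ (2 * k) * f.coeff j k)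
    (by intro f g j k; simp; ring) (by intro c f j k; simp; ring)
    (by
      intro j k
      have := Distr.continuous_coeff (q := q)
      fun_prop)

/-- `K⁻¹` in coordinates. -/
def dKinv (q : Set.Ioo (0 : ℝ) 1) : Distr q →L[ℂ] Distr q :=
  Distr.op (fun f j k => qc q ^ (2 * k) / qc q ^ (2 * j) * f.coeff j k)
    (by intro f g j k; simp; ring) (by intro c f j k; simp; ring)
    (by
      intro j k
      have := Distr.continuous_coeff (q := q)
      fun_prop)

/-- `E` in coordinates. -/
def dE (q : Set.Ioo (0 : ℝ) 1) : Distr q →L[ℂ] Distr q :=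
  Distr.op (fun f j k =>
      (match j with | 0 => 0 | j + 1 => -(qh q * qnum q j) * f.coeff j k) +
        qc q ^ (2 * j) * qh q / qc q ^ (2 * (k + 1)) * qnum q (k + 1) * f.coeff j (k + 1))
    (by intro f g j k; cases j <;> simp <;> ring)
    (by intro c f j k; cases j <;> simp <;> ring)
    (by
      intro j k
      have := Distr.continuous_coeff (q := q)
      cases j <;> dsimp only <;> fun_prop)

/-- `F` in coordinates. -/
def dF (q : Set.Ioo (0 : ℝ) 1) : Distr q →L[ℂ] Distr q :=
  Distr.op (fun f j k =>
      (match k with | 0 => 0 | k + 1 => -(qh q * qc q ^ 2 * qnum q k) * f.coeff j k) +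
        qc q ^ (2 * k) * qh q / qc q ^ (2 * j) * qnum q (j + 1) * f.coeff (j + 1) k)
    (by intro f g j k; cases k <;> simp <;> ring)
    (by intro c f j k; cases k <;> simp <;> ring)
    (by
      intro j k
      have := Distr.continuous_coeff (q := q)
      cases k <;> dsimp only <;> fun_prop)

section
variable {q : Set.Ioo (0 : ℝ) 1} (f : Distr q) (j k : ℕ)

@[simp] theorem coeff_dK :
    (dK q f).coeff j k = qc q ^ (2 * j) / qc q ^ (2 * k) * f.coeff j k := rfl
@[simp] theorem coeff_dKinv :
    (dKinv q f).coeff j k = qc q ^ (2 * k) / qc q ^ (2 * j) * f.coeff j k := rfl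
@[simp] theorem dE_zero : (dE q f).coeff 0 k =
    qc q ^ (2 * 0) * qh q / qc q ^ (2 * (k + 1)) * qnum q (k + 1) * f.coeff 0 (k + 1) :=
  zero_add _
@[simp] theorem dE_succ : (dE q f).coeff (j + 1) k = -(qh q * qnum q j) * f.coeff j k +
    qc q ^ (2 * (j + 1)) * qh q / qc q ^ (2 * (k + 1)) * qnum q (k + 1) *
      f.coeff (j + 1) (k + 1) := rfl
@[simp] theorem dF_zero : (dF q f).coeff j 0 =
    qc q ^ (2 * 0) * qh q / qc q ^ (2 * j) * qnum q (j + 1) * f.coeff (j + 1) 0 :=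
  zero_add _
@[simp] theorem dF_succ : (dF q f).coeff j (k + 1) =
    -(qh q * qc q ^ 2 * qnum q k) * f.coeff j k +
    qc q ^ (2 * (k + 1)) * qh q / qc q ^ (2 * j) * qnum q (j + 1) *
      f.coeff (j + 1) (k + 1) := rfl

theorem dK_leftZ : dK q (leftZ q f) = qc q ^ 2 • leftZ q (dK q f) := by
  apply Distr.ext'
  rintro (_ | j) k <;> simp <;> ring

theorem dK_leftZs : dK q (leftZs q f) = (qc q ^ 2)⁻¹ • leftZs q (dK q f) := by
  have := qc_ne q
  apply Distr.ext'
  rintro j (_ | k) <;> simp <;> field_simp <;> ring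

theorem dKinv_leftZ : dKinv q (leftZ q f) = (qc q ^ 2)⁻¹ • leftZ q (dKinv q f) := by
  have := qc_ne q
  apply Distr.ext'
  rintro (_ | j) k <;> simp <;> field_simp <;> ring

theorem dKinv_leftZs : dKinv q (leftZs q f) = qc q ^ 2 • leftZs q (dKinv q f) := by
  have := qc_ne q
  apply Distr.ext'
  rintro j (_ | k) <;> simp <;> field_simp <;> ring

theorem dE_leftZ : dE q (leftZ q f) =
    -(qh q • leftZ q (leftZ q f)) + qc q ^ 2 • leftZ q (dE q f) := by
  have := qc_ne q
  have := one_sub_ne q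
  apply Distr.ext'
  rintro (_ | _ | j) k <;> simp [qnum] <;> field_simp <;> ring

theorem dE_leftZs : dE q (leftZs q f) =
    (qh q / qc q ^ 2) • f + (qc q ^ 2)⁻¹ • leftZs q (dE q f) := by
  have := qc_ne q
  have := one_sub_ne q
  apply Distr.ext'
  rintro (_ | j) (_ | k) <;> simp [qnum] <;> field_simp <;> ring

theorem dF_leftZ : dF q (leftZ q f) = qh q • dKinv q f + leftZ q (dF q f) := by
  have := qc_ne q
  have := one_sub_ne q
  apply Distr.ext'
  rintro (_ | j) (_ | k) <;> simp [qnum] <;> field_simp <;> first | ring1 | simp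

theorem dF_leftZs : dF q (leftZs q f) =
    -((qh q * qc q ^ 2) • leftZs q (leftZs q (dKinv q f))) + leftZs q (dF q f) := by
  have := qc_ne q
  have := one_sub_ne q
  apply Distr.ext'
  rintro j (_ | _ | k) <;> simp [qnum] <;> field_simp <;> ring

end

theorem isExt_K (q : Set.Ioo (0 : ℝ) 1) : IsExt (polGen q .K) (dK q) := by
  intro f
  change dK q _ = toDistr q (polK q f)
  induction f using pol_induction with
  | h1 =>
    rw [map_one (polK q), toDistr_one]
    apply Distr.ext'
    rintro (_ | j) (_ | k) <;> simp [mono]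
  | hadd f g hf hg => simp [hf, hg]
  | hsmul c f hf => simp [hf]
  | hz f hf => simp [toDistr_z_mul, dK_leftZ, hf]
  | hzs f hf => simp [toDistr_zs_mul, dK_leftZs, hf]

theorem isExt_Kinv (q : Set.Ioo (0 : ℝ) 1) : IsExt (polGen q .Kinv) (dKinv q) := by
  intro f
  change dKinv q _ = toDistr q (polKinv q f)
  induction f using pol_induction with
  | h1 =>
    rw [map_one (polKinv q), toDistr_one]
    apply Distr.ext'
    rintro (_ | j) (_ | k) <;> simp [mono]
  | hadd f g hf hg => simp [hf, hg]
  | hsmul c f hf => simp [hf]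
  | hz f hf => simp [toDistr_z_mul, dKinv_leftZ, hf]
  | hzs f hf => simp [toDistr_zs_mul, dKinv_leftZs, hf]

theorem isExt_E (q : Set.Ioo (0 : ℝ) 1) : IsExt (polGen q .E) (dE q) := by
  intro f
  change dE q _ = toDistr q (polE q f)
  induction f using pol_induction with
  | h1 =>
    rw [polE_one, map_zero, toDistr_one]
    apply Distr.ext'
    rintro (_ | _ | j) (_ | k) <;> simp [mono, qnum]
  | hadd f g hf hg => simp [hf, hg]
  | hsmul c f hf => simp [hf]
  | hz f hf => simp [toDistr_z_mul, polE_mul, dE_leftZ, hf, mul_assoc]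
  | hzs f hf => simp [toDistr_zs_mul, polE_mul, dE_leftZs, hf]

theorem isExt_F (q : Set.Ioo (0 : ℝ) 1) : IsExt (polGen q .F) (dF q) := by
  intro f
  change dF q _ = toDistr q (polF q f)
  have hK : ∀ g, toDistr q (polKinv q g) = dKinv q (toDistr q g) :=
    fun g => (isExt_Kinv q g).symm
  induction f using pol_induction with
  | h1 =>
    rw [polF_one, map_zero, toDistr_one]
    apply Distr.ext'
    rintro (_ | j) (_ | _ | k) <;> simp [mono, qnum]
  | hadd f g hf hg => simp [hf, hg]
  | hsmul c f hf => simp [hf]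
  | hz f hf => simp [toDistr_z_mul, polF_mul, dF_leftZ, hf, hK]
  | hzs f hf => simp [toDistr_zs_mul, polF_mul, dF_leftZs, hf, hK, mul_assoc]

/-- Every element of `U_q sl₂` acts on `Pol(ℂ)_q` by an operator that extends by continuity
to `D(U)_q'`. -/
theorem exists_isExt (q : Set.Ioo (0 : ℝ) 1) (a : Uq q) : ∃ T', IsExt (polAct q a) T' := by
  induction a using u_induction with
  | hc c => exact ⟨c • 1, fun f => by simp [Algebra.algebraMap_eq_smul_one]⟩
  | hadd a b ha hb =>
    obtain ⟨A, hA⟩ := ha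
    obtain ⟨B, hB⟩ := hb
    exact ⟨A + B, fun f => by simp [hA f, hB f]⟩
  | hmul a b ha hb =>
    obtain ⟨A, hA⟩ := ha
    obtain ⟨B, hB⟩ := hb
    exact ⟨A * B, fun f => by simp [hA _, hB f]⟩
  | hg g =>
    rw [polAct_ugen]
    cases g
    · exact ⟨_, isExt_K q⟩
    · exact ⟨_, isExt_Kinv q⟩
    · exact ⟨_, isExt_E q⟩
    · exact ⟨_, isExt_F q⟩

/-- The extension by continuity to `D(U)_q'` of the action of `a ∈ U_q sl₂` on `Pol(ℂ)_q`. -/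
def actFun (q : Set.Ioo (0 : ℝ) 1) (a : Uq q) : Distr q →L[ℂ] Distr q :=
  (exists_isExt q a).choose

theorem isExt_actFun (q : Set.Ioo (0 : ℝ) 1) (a : Uq q) : IsExt (polAct q a) (actFun q a) :=
  (exists_isExt q a).choose_spec

/-- The action of `U_q sl₂` on `D(U)_q'`. -/
def act (q : Set.Ioo (0 : ℝ) 1) : Uq q →ₐ[ℂ] (Distr q →L[ℂ] Distr q) where
  toFun := actFun q
  map_one' := (isExt_actFun q 1).unique fun f => by simp
  map_mul' a b := (isExt_actFun q (a * b)).unique fun f => by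
    simp [isExt_actFun q a _, isExt_actFun q b f]
  map_zero' := (isExt_actFun q 0).unique fun f => by simp
  map_add' a b := (isExt_actFun q (a + b)).unique fun f => by
    simp [isExt_actFun q a _, isExt_actFun q b f]
  commutes' c := (isExt_actFun q _).unique fun f => by
    simp [Algebra.algebraMap_eq_smul_one]

instance (q : Set.Ioo (0 : ℝ) 1) : Module (Uq q) (Distr q) :=
  Module.compHom (Distr q) (act q).toRingHom

theorem smul_def (q : Set.Ioo (0 : ℝ) 1) (a : Uq q) (f : Distr q) : a • f = act q a f := rfl

theorem algebraMap_smul' (q : Set.Ioo (0 : ℝ) 1) (c : ℂ) (f : Distr q) :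
    algebraMap ℂ (Uq q) c • f = c • f := by
  rw [smul_def, AlgHom.commutes, Algebra.algebraMap_eq_smul_one]
  simp

theorem smul_toDistr (q : Set.Ioo (0 : ℝ) 1) (a : Uq q) (f : Pol q) :
    a • toDistr q f = toDistr q (polAct q a f) := isExt_actFun q a f

theorem act_K (q : Set.Ioo (0 : ℝ) 1) : act q (ugen q .K) = dK q :=
  (isExt_actFun q _).unique (by rw [polAct_ugen]; exact isExt_K q)

theorem act_Kinv (q : Set.Ioo (0 : ℝ) 1) : act q (ugen q .Kinv) = dKinv q :=
  (isExt_actFun q _).unique (by rw [polAct_ugen]; exact isExt_Kinv q)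

theorem act_E (q : Set.Ioo (0 : ℝ) 1) : act q (ugen q .E) = dE q :=
  (isExt_actFun q _).unique (by rw [polAct_ugen]; exact isExt_E q)

theorem act_F (q : Set.Ioo (0 : ℝ) 1) : act q (ugen q .F) = dF q :=
  (isExt_actFun q _).unique (by rw [polAct_ugen]; exact isExt_F q)

/-! ### Finite functions -/

theorem dK_rightZ {q : Set.Ioo (0 : ℝ) 1} (f : Distr q) :
    dK q (rightZ q f) = qc q ^ 2 • rightZ q (dK q f) := by
  have := qc_ne q
  apply Distr.ext'
  rintro (_ | j) k <;> simp <;> field_simp <;> ring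

theorem dKinv_rightZ {q : Set.Ioo (0 : ℝ) 1} (f : Distr q) :
    dKinv q (rightZ q f) = (qc q ^ 2)⁻¹ • rightZ q (dKinv q f) := by
  have := qc_ne q
  apply Distr.ext'
  rintro (_ | j) k <;> simp <;> field_simp <;> ring

theorem dE_rightZ {q : Set.Ioo (0 : ℝ) 1} (f : Distr q) :
    dE q (rightZ q f) = rightZ q (dE q f) - qh q • rightZ q (rightZ q (dK q f)) := by
  have h : dE q * rightZ q = rightZ q * dE q - qh q • (rightZ q * rightZ q * dK q) := by
    refine distr_hom_ext fun g => ?_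
    have h1 := isExt_E q (g * z q)
    have h2 := isExt_E q g
    have h3 := isExt_K q g
    simp only [polGen, AlgHom.toLinearMap_apply] at h1 h2 h3
    rw [toDistr_mul_z, polE_mul, polE_z] at h1
    simp [h1, h2, h3, toDistr_mul_z, ← mul_assoc, sub_eq_add_neg]
  exact congrArg (fun A : Distr q →L[ℂ] Distr q => A f) h

theorem dF_rightZ {q : Set.Ioo (0 : ℝ) 1} (f : Distr q) :
    dF q (rightZ q f) = (qc q ^ 2)⁻¹ • rightZ q (dF q f) + qh q • f := by
  have h : dF q * rightZ q = (qc q ^ 2)⁻¹ • (rightZ q * dF q) + qh q • 1 := by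
    refine distr_hom_ext fun g => ?_
    have h1 := isExt_F q (g * z q)
    have h2 := isExt_F q g
    simp only [polGen] at h1 h2
    rw [toDistr_mul_z, polF_mul, polF_z] at h1
    simp [h1, h2, toDistr_mul_z]
  exact congrArg (fun A : Distr q →L[ℂ] Distr q => A f) h

/-- The condition `z*^N f = f z^N = 0` for some `N`. -/
def IsFinite {q : Set.Ioo (0 : ℝ) 1} (f : Distr q) : Prop :=
  ∃ N : ℕ, (leftZs q ^ N) f = 0 ∧ (rightZ q ^ N) f = 0

theorem pow_apply_eq_zero_of_le {q : Set.Ioo (0 : ℝ) 1} (A : Distr q →L[ℂ] Distr q) {M N : ℕ}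
    (h : M ≤ N) {f : Distr q} (hf : (A ^ M) f = 0) : (A ^ N) f = 0 := by
  obtain ⟨c, rfl⟩ := Nat.exists_eq_add_of_le' h
  rw [pow_add, mul_apply_eq_comp, hf, map_zero]

/-- If `A T f` is a combination of `T A f` and of elements that are killed by powers of `A` as
soon as `f` is, then `T` preserves the elements that are killed by a power of `A`. -/
theorem pow_apply_stable {q : Set.Ioo (0 : ℝ) 1} (A T S : Distr q →L[ℂ] Distr q) (c : ℂ)
    (hS : ∀ N f, (A ^ N) f = 0 → (A ^ N) (S f) = 0)
    (h : ∀ f, A (T f) = c • T (A f) + S f) (N : ℕ) :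
    ∀ f, (A ^ N) f = 0 → (A ^ (N + 1)) (T f) = 0 := by
  induction N with
  | zero =>
    intro f hf
    have : f = 0 := by simpa using hf
    simp [this]
  | succ N ih =>
    intro f hf
    have h1 : (A ^ N) (A f) = 0 := by
      rw [pow_succ] at hf
      exact hf
    have h2 := ih _ h1
    rw [pow_succ, mul_apply_eq_comp, h, map_add, map_smul, h2, hS _ _ hf]
    simp

theorem pow_apply_comm {q : Set.Ioo (0 : ℝ) 1} (A T : Distr q →L[ℂ] Distr q) (c : ℂ)
    (h : ∀ f, A (T f) = c • T (A f)) (N : ℕ) :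
    ∀ f, (A ^ N) f = 0 → (A ^ N) (T f) = 0 := by
  induction N with
  | zero =>
    intro f hf
    have : f = 0 := by simpa using hf
    simp [this]
  | succ N ih =>
    intro f hf
    rw [pow_succ, mul_apply_eq_comp] at hf ⊢
    rw [h, map_smul, ih _ hf, smul_zero]

theorem leftZs_dK {q : Set.Ioo (0 : ℝ) 1} (f : Distr q) :
    leftZs q (dK q f) = qc q ^ 2 • dK q (leftZs q f) := by
  rw [dK_leftZs, smul_smul, mul_inv_cancel₀ (pow_ne_zero 2 (qc_ne q)), one_smul]

theorem leftZs_dKinv {q : Set.Ioo (0 : ℝ) 1} (f : Distr q) :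
    leftZs q (dKinv q f) = (qc q ^ 2)⁻¹ • dKinv q (leftZs q f) := by
  rw [dKinv_leftZs, smul_smul, inv_mul_cancel₀ (pow_ne_zero 2 (qc_ne q)), one_smul]

theorem rightZ_dK {q : Set.Ioo (0 : ℝ) 1} (f : Distr q) :
    rightZ q (dK q f) = (qc q ^ 2)⁻¹ • dK q (rightZ q f) := by
  rw [dK_rightZ, smul_smul, inv_mul_cancel₀ (pow_ne_zero 2 (qc_ne q)), one_smul]

theorem rightZ_dKinv {q : Set.Ioo (0 : ℝ) 1} (f : Distr q) :
    rightZ q (dKinv q f) = qc q ^ 2 • dKinv q (rightZ q f) := by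
  rw [dKinv_rightZ, smul_smul, mul_inv_cancel₀ (pow_ne_zero 2 (qc_ne q)), one_smul]

theorem isFinite_gen {q : Set.Ioo (0 : ℝ) 1} (g : UGen) {f : Distr q} (hf : IsFinite f) :
    IsFinite (ugen q g • f) := by
  have h0 := qc_ne q
  obtain ⟨N, hl, hr⟩ := hf
  rw [smul_def]
  have key : ∀ (A B : Distr q →L[ℂ] Distr q) (c d : ℂ) (N : ℕ) (f : Distr q),
      (∀ f, A (B f) = c • B (A f)) → (A ^ N) f = 0 → (A ^ N) ((d • (A ^ 2 * B)) f) = 0 := by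
    intro A B c d N f hAB hf
    have h1 := pow_apply_comm A B c hAB N f hf
    have h2 : (A ^ N) ((A ^ 2) (B f)) = 0 := by
      rw [← mul_apply_eq_comp, ← pow_add, add_comm, pow_add,
        mul_apply_eq_comp, h1, map_zero]
    simp only [smul_apply, mul_apply_eq_comp, map_smul, h2,
      smul_zero]
  cases g
  · rw [act_K]
    exact ⟨N, pow_apply_comm _ _ _ leftZs_dK _ _ hl, pow_apply_comm _ _ _ rightZ_dK _ _ hr⟩
  · rw [act_Kinv]
    exact ⟨N, pow_apply_comm _ _ _ leftZs_dKinv _ _ hl, pow_apply_comm _ _ _ rightZ_dKinv _ _ hr⟩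
  · rw [act_E]
    refine ⟨N + 1, pow_apply_stable (leftZs q) (dE q) (-(qh q) • 1) (qc q ^ 2) ?_ ?_ N f hl,
      pow_apply_stable (rightZ q) (dE q) (qh q • (rightZ q ^ 2 * dK q)) 1 ?_ ?_ N f hr⟩
    · intro N f hf
      rw [smul_apply, one_apply_eq_self, map_smul, hf, smul_zero]
    · intro f
      rw [dE_leftZs]
      simp only [smul_apply, one_apply_eq_self]
      match_scalars <;> field_simp <;> ring
    · exact fun N f hf => key _ _ _ _ N f rightZ_dK hf
    · intro f
      rw [dE_rightZ]
      simp [pow_two]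
  · rw [act_F]
    refine ⟨N + 1, pow_apply_stable (leftZs q) (dF q)
        ((qh q * qc q ^ 2) • (leftZs q ^ 2 * dKinv q)) 1 ?_ ?_ N f hl,
      pow_apply_stable (rightZ q) (dF q) (-(qh q * qc q ^ 2) • 1) (qc q ^ 2) ?_ ?_ N f hr⟩
    · exact fun N f hf => key _ _ _ _ N f leftZs_dKinv hf
    · intro f
      rw [dF_leftZs]
      simp [pow_two]
    · intro N f hf
      rw [smul_apply, one_apply_eq_self, map_smul, hf, smul_zero]
    · intro f
      rw [dF_rightZ]
      simp only [smul_apply, one_apply_eq_self]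
      match_scalars <;> field_simp <;> ring

/-- The `U_q sl₂`-module `D(U)_q` of finite functions in the quantum disc, as a submodule of the
`U_q sl₂`-module `D(U)_q'`: it consists of the `f` with `z*^N f = f z^N = 0` for some `N`. -/
def finiteFunctions (q : Set.Ioo (0 : ℝ) 1) : Submodule (Uq q) (Distr q) where
  carrier := {f | IsFinite f}
  zero_mem' := ⟨0, by simp, by simp⟩
  add_mem' := by
    rintro f g ⟨M, hM1, hM2⟩ ⟨N, hN1, hN2⟩
    refine ⟨max M N, ?_, ?_⟩
    · rw [map_add, pow_apply_eq_zero_of_le _ (le_max_left M N) hM1,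
        pow_apply_eq_zero_of_le _ (le_max_right M N) hN1, add_zero]
    · rw [map_add, pow_apply_eq_zero_of_le _ (le_max_left M N) hM2,
        pow_apply_eq_zero_of_le _ (le_max_right M N) hN2, add_zero]
  smul_mem' := by
    intro a
    induction a using u_induction with
    | hc c =>
      rintro f ⟨N, h1, h2⟩
      exact ⟨N, by rw [algebraMap_smul', map_smul, h1, smul_zero],
        by rw [algebraMap_smul', map_smul, h2, smul_zero]⟩
    | hadd a b ha hb =>
      intro f hf
      obtain ⟨M, hM1, hM2⟩ := ha hf
      obtain ⟨N, hN1, hN2⟩ := hb hf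
      refine ⟨max M N, ?_, ?_⟩
      · rw [add_smul, map_add, pow_apply_eq_zero_of_le _ (le_max_left M N) hM1,
          pow_apply_eq_zero_of_le _ (le_max_right M N) hN1, add_zero]
      · rw [add_smul, map_add, pow_apply_eq_zero_of_le _ (le_max_left M N) hM2,
          pow_apply_eq_zero_of_le _ (le_max_right M N) hN2, add_zero]
    | hmul a b ha hb =>
      intro f hf
      rw [mul_smul]
      exact ha (hb hf)
    | hg g => exact fun {f} hf => isFinite_gen g hf

/-! ### Matrix elements -/

/-- The operator `T(z) e_m = (1 - q^(2(m+1)))^(1/2) e_(m+1)`. -/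
def fockZ (q : Set.Ioo (0 : ℝ) 1) : Module.End ℂ (ℕ →₀ ℂ) :=
  Finsupp.linearCombination ℂ fun m =>
    Finsupp.single (m + 1) ((Real.sqrt (1 - (q : ℝ) ^ (2 * (m + 1))) : ℝ) : ℂ)

/-- The operator `T(z*) e_m = (1 - q^(2m))^(1/2) e_(m-1)`, with `T(z*) e_0 = 0`. -/
def fockZs (q : Set.Ioo (0 : ℝ) 1) : Module.End ℂ (ℕ →₀ ℂ) :=
  Finsupp.linearCombination ℂ fun m =>
    Finsupp.single (m - 1) ((Real.sqrt (1 - (q : ℝ) ^ (2 * m)) : ℝ) : ℂ)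

theorem fock_sqrt_sq (q : Set.Ioo (0 : ℝ) 1) (m : ℕ) :
    ((Real.sqrt (1 - (q : ℝ) ^ (2 * m)) : ℝ) : ℂ) * ((Real.sqrt (1 - (q : ℝ) ^ (2 * m)) : ℝ) : ℂ)
      = 1 - qc q ^ (2 * m) := by
  rw [← Complex.ofReal_mul, Real.mul_self_sqrt]
  · simp [qc]
  · have := pow_le_one₀ (n := 2 * m) q.2.1.le q.2.2.le
    linarith

/-- The representation `T` of `Pol(ℂ)_q` by operators in the space with the basis `e_m`,
`m = 0, 1, 2, …`, for which `T(z)` and `T(z*)` are adjoint to each other. -/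
def fock (q : Set.Ioo (0 : ℝ) 1) : Pol q →ₐ[ℂ] Module.End ℂ (ℕ →₀ ℂ) :=
  polLift q (fockZ q) (fockZs q) (by
    refine Finsupp.lhom_ext' fun m => LinearMap.ext_ring ?_
    rcases m with _ | m
    · have h1 := fock_sqrt_sq q 1
      ext i
      simp [fockZ, fockZs, Finsupp.single_apply] at h1 ⊢
      split_ifs
      · linear_combination h1
      · ring
    · have h1 := fock_sqrt_sq q (m + 1)
      have h2 := fock_sqrt_sq q (m + 1 + 1)
      ext i
      simp [fockZ, fockZs, Finsupp.single_apply]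
      split_ifs
      · linear_combination h2 - qc q ^ 2 * h1
      · ring)

@[simp] theorem fock_z (q : Set.Ioo (0 : ℝ) 1) : fock q (z q) = fockZ q := polLift_z ..
@[simp] theorem fock_zs (q : Set.Ioo (0 : ℝ) 1) : fock q (zs q) = fockZs q := polLift_zs ..

/-- `T(z^j)` has its range in the span of the `e_m` with `m ≥ j`. -/
theorem fockZ_pow_apply (q : Set.Ioo (0 : ℝ) 1) (j : ℕ) (v : ℕ →₀ ℂ) :
    ∀ m < j, (fockZ q ^ j) v m = 0 := by
  induction j with
  | zero => simp
  | succ j ih =>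
    have key : ∀ w : ℕ →₀ ℂ, fockZ q w 0 = 0 ∧ ∀ m, w m = 0 → fockZ q w (m + 1) = 0 := by
      intro w
      refine ⟨?_, fun m hm => ?_⟩
      · rw [fockZ, Finsupp.linearCombination_apply, Finsupp.sum_apply]
        exact Finset.sum_eq_zero fun i _ => by simp
      · rw [fockZ, Finsupp.linearCombination_apply, Finsupp.sum_apply]
        refine Finset.sum_eq_zero fun i _ => ?_
        rcases eq_or_ne i m with rfl | h
        · simp [hm]
        · simp [Finsupp.single_apply, h]
    intro m hm
    rw [pow_succ', Module.End.mul_apply]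
    rcases m with _ | m
    · exact (key _).1
    · exact (key _).2 m (ih m (by omega))

/-- `T(z*^k) e_n = 0` for `k > n`. -/
theorem fockZs_pow_single (q : Set.Ioo (0 : ℝ) 1) (k : ℕ) :
    ∀ n < k, ∀ c : ℂ, (fockZs q ^ k) (Finsupp.single n c) = 0 := by
  induction k with
  | zero => simp
  | succ k ih =>
    intro n hn c
    rw [pow_succ, Module.End.mul_apply]
    rcases n with _ | n
    · simp [fockZs]
    · rw [fockZs, Finsupp.linearCombination_single, Finsupp.smul_single]
      exact ih n (by omega) _

/-- The monomials `z^j z*^k` with `j > m` or `k > n` do not contribute to the matrix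
element with the indices `m`, `n`. -/
theorem fock_monomial_eq_zero (q : Set.Ioo (0 : ℝ) 1) (j k m n : ℕ) (h : m < j ∨ n < k) :
    fock q (z q ^ j * zs q ^ k) (Finsupp.single n 1) m = 0 := by
  rw [map_mul, map_pow, map_pow, fock_z, fock_zs, Module.End.mul_apply]
  rcases h with h | h
  · exact fockZ_pow_apply q j _ m h
  · rw [fockZs_pow_single q k n h, map_zero, Finsupp.zero_apply]

/-- The matrix element `l_{mn}(f)`, i.e. the coefficient of `e_m` in `T(f) e_n`, for a formal
series `f = ∑ a_{jk} z^j z*^k`.  It is the sum of `a_{jk} l_{mn}(z^j z*^k)` over all `j`, `k`,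
where only the terms with `j ≤ m` and `k ≤ n` can be different from `0`. -/
def matrixElem (q : Set.Ioo (0 : ℝ) 1) (m n : ℕ) (f : Distr q) : ℂ :=
  ∑ j ∈ Finset.range (m + 1), ∑ k ∈ Finset.range (n + 1),
    f.coeff j k * fock q (z q ^ j * zs q ^ k) (Finsupp.single n 1) m

end

end QDisc

/-!
On matrix elements, left and right multiplication by `z` and `z*` are weighted shifts of rows and
columns, with nonzero weights.  Hence the `l_{mn}` identify `D(U)_q'` with the `ℕ × ℕ` matrices
and `D(U)_q` with the finitely supported ones, and `f₀` is the matrix unit at `(0, 0)`.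

On the other hand `E` and `F` are inner twisted derivations: up to nonzero scalars, `E f` is
`z f - (K f) z` and `F f` is `z* (K⁻¹ f) - f z*`.  Right multiplication by `z` kills column `0`, so
on that column `E` acts as the left shift by `z` and produces all of its matrix units from `f₀`.
Left multiplication by `z*` only lowers the row, so `F` produces the matrix units of column `n + 1`
from those of column `n`.
-/

namespace QDisc

theorem mul_pow_succ_of_qCommutation {R A : Type*} [CommRing R] [Ring A] [Algebra R A] {s : R}
    {a b : A} (h : b * a = s • (a * b) + (1 - s) • 1) (n : ℕ) :
    b * a ^ (n + 1) = s ^ (n + 1) • (a ^ (n + 1) * b) + (1 - s ^ (n + 1)) • a ^ n := by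
  induction n with
  | zero => simpa using h
  | succ n ih =>
    calc b * a ^ (n + 1 + 1)
        = s • (a * (b * a ^ (n + 1))) + (1 - s) • a ^ (n + 1) := by
          rw [pow_succ' a (n + 1), ← mul_assoc, h, add_mul, smul_mul_assoc, smul_mul_assoc,
            one_mul, mul_assoc]
      _ = s ^ (n + 1 + 1) • (a ^ (n + 1 + 1) * b) + (1 - s ^ (n + 1 + 1)) • a ^ (n + 1) := by
          rw [ih, mul_add, mul_smul_comm, mul_smul_comm, ← mul_assoc, ← pow_succ', ← pow_succ']
          module

variable {q : Set.Ioo (0 : ℝ) 1}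

theorem qh_ne_zero : qh q ≠ 0 := fun h => qc_ne q (by rw [← qh_sq, h, zero_pow two_ne_zero])

theorem pow_two_mul_succ_lt_one (n : ℕ) : (q : ℝ) ^ (2 * (n + 1)) < 1 :=
  pow_lt_one₀ q.2.1.le q.2.2 (by positivity)

theorem one_sub_qc_pow_ne_zero (n : ℕ) : 1 - qc q ^ (2 * (n + 1)) ≠ 0 := by
  have h : (1 : ℝ) - (q : ℝ) ^ (2 * (n + 1)) ≠ 0 := (sub_pos.2 (pow_two_mul_succ_lt_one n)).ne'
  rw [qc]
  exact_mod_cast h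

/-! ### Density of the polynomials -/

theorem span_monomials :
    Submodule.span ℂ (Set.range fun i : ℕ × ℕ => z q ^ i.1 * zs q ^ i.2) = ⊤ := by
  set V := Submodule.span ℂ (Set.range fun i : ℕ × ℕ => z q ^ i.1 * zs q ^ i.2)
  have mem (j k : ℕ) : z q ^ j * zs q ^ k ∈ V := Submodule.subset_span ⟨(j, k), rfl⟩
  have z_mul : V ≤ V.comap (LinearMap.mulLeft ℂ (z q)) := by
    rw [Submodule.span_le]
    rintro _ ⟨⟨j, k⟩, rfl⟩
    have h := mem (j + 1) k
    rwa [pow_succ', mul_assoc] at h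
  have zs_mul : V ≤ V.comap (LinearMap.mulLeft ℂ (zs q)) := by
    rw [Submodule.span_le]
    rintro _ ⟨⟨_ | j, k⟩, rfl⟩
    · simpa [← pow_succ'] using mem 0 (k + 1)
    · have h : zs q * (z q ^ (j + 1) * zs q ^ k) =
          (qc q ^ 2) ^ (j + 1) • (z q ^ (j + 1) * zs q ^ (k + 1)) +
            (1 - (qc q ^ 2) ^ (j + 1)) • (z q ^ j * zs q ^ k) := by
        rw [← mul_assoc, mul_pow_succ_of_qCommutation (zs_mul_z q), add_mul, smul_mul_assoc,
          smul_mul_assoc, mul_assoc, ← pow_succ']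
      have h_mem := V.add_mem (V.smul_mem ((qc q ^ 2) ^ (j + 1)) (mem (j + 1) (k + 1)))
        (V.smul_mem (1 - (qc q ^ 2) ^ (j + 1)) (mem j k))
      rwa [← h] at h_mem
  refine Submodule.eq_top_iff'.2 fun p => ?_
  induction p using pol_induction with
  | h1 => simpa using mem 0 0
  | hadd f g hf hg => exact V.add_mem hf hg
  | hsmul c f hf => exact V.smul_mem c hf
  | hz f hf => exact z_mul hf
  | hzs f hf => exact zs_mul hf

theorem hasSum_coeff_smul_mono (f : Distr q) :
    HasSum (fun i : ℕ × ℕ => f.coeff i.1 i.2 • mono q i.1 i.2) f := by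
  refine Pi.hasSum.2 fun i => ?_
  convert hasSum_ite_eq i (f i) using 2 with b
  change f b * (if i.1 = b.1 ∧ i.2 = b.2 then 1 else 0) = _
  rcases eq_or_ne b i with rfl | h
  · simp
  · have h' : ¬(i.1 = b.1 ∧ i.2 = b.2) := fun h' => h (Prod.ext h'.1.symm h'.2.symm)
    rw [if_neg h', if_neg h, mul_zero]

theorem denseRange_toDistr : DenseRange (toDistr q) := fun f =>
  mem_closure_of_tendsto (hasSum_coeff_smul_mono f) <| .of_forall fun s =>
    ⟨∑ i ∈ s, f.coeff i.1 i.2 • (z q ^ i.1 * zs q ^ i.2), by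
      simp only [map_sum, map_smul, toDistr_monomial]⟩

theorem clm_ext_toDistr {M : Type*} [AddCommMonoid M] [Module ℂ M] [TopologicalSpace M] [T2Space M]
    {A B : Distr q →L[ℂ] M} (h : ∀ p, A (toDistr q p) = B (toDistr q p)) : A = B :=
  DFunLike.coe_injective (denseRange_toDistr.equalizer A.continuous B.continuous (funext h))

/-- Right multiplication by `z*`: `z^j z*^k · z* = z^j z*^(k+1)`. -/
noncomputable def rightZs (q : Set.Ioo (0 : ℝ) 1) : Distr q →L[ℂ] Distr q :=
  Distr.op (fun f j k => match k with | 0 => 0 | k + 1 => f.coeff j k)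
    (by intro f g j k; cases k <;> simp)
    (by intro c f j k; cases k <;> simp)
    (by intro j k; cases k <;> simp [Distr.continuous_coeff, continuous_const])

@[simp] theorem rightZs_zero (f : Distr q) (j : ℕ) : (rightZs q f).coeff j 0 = 0 := rfl

@[simp] theorem rightZs_succ (f : Distr q) (j k : ℕ) :
    (rightZs q f).coeff j (k + 1) = f.coeff j k := rfl

theorem leftZ_rightZs (f : Distr q) : leftZ q (rightZs q f) = rightZs q (leftZ q f) := by
  apply Distr.ext'
  rintro (_ | j) (_ | k) <;> simp

theorem leftZs_rightZs (f : Distr q) : leftZs q (rightZs q f) = rightZs q (leftZs q f) := by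
  apply Distr.ext'
  rintro j (_ | _ | k) <;> simp

theorem toDistr_mul_zs (p : Pol q) : toDistr q (p * zs q) = rightZs q (toDistr q p) := by
  induction p using pol_induction with
  | h1 =>
    have h := toDistr_monomial q 0 1
    rw [pow_zero, pow_one] at h
    rw [h, toDistr_one]
    apply Distr.ext'
    rintro j (_ | k) <;> simp [mono]
  | hadd f g hf hg => simp only [add_mul, map_add, hf, hg]
  | hsmul c f hf => simp only [smul_mul_assoc, map_smul, hf]
  | hz f hf => rw [mul_assoc, toDistr_z_mul, hf, toDistr_z_mul, leftZ_rightZs]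
  | hzs f hf => rw [mul_assoc, toDistr_zs_mul, hf, toDistr_zs_mul, leftZs_rightZs]

/-! ### Matrix elements of products -/

/-- The weight `(1 - q^(2n))^(1/2)` of the shifts `T(z)` and `T(z*)` between `e_(n-1)` and `e_n`. -/
noncomputable def fockWeight (q : Set.Ioo (0 : ℝ) 1) (n : ℕ) : ℂ :=
  ((Real.sqrt (1 - (q : ℝ) ^ (2 * n)) : ℝ) : ℂ)

theorem fockWeight_succ_ne_zero (n : ℕ) : fockWeight q (n + 1) ≠ 0 :=
  Complex.ofReal_ne_zero.2 (Real.sqrt_ne_zero'.2 (sub_pos.2 (pow_two_mul_succ_lt_one n)))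

theorem fockZ_single (n : ℕ) :
    fockZ q (Finsupp.single n 1) = fockWeight q (n + 1) • Finsupp.single (n + 1) 1 := by
  simp [fockZ, fockWeight]

theorem fockZs_single_zero : fockZs q (Finsupp.single 0 1) = 0 := by
  simp [fockZs]

theorem fockZs_single_succ (n : ℕ) :
    fockZs q (Finsupp.single (n + 1) 1) = fockWeight q (n + 1) • Finsupp.single n 1 := by
  simp [fockZs, fockWeight]

theorem fockZ_apply_zero (v : ℕ →₀ ℂ) : fockZ q v 0 = 0 := by
  simpa using fockZ_pow_apply q 1 v 0 zero_lt_one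

theorem fockZ_apply_succ (v : ℕ →₀ ℂ) (m : ℕ) : fockZ q v (m + 1) = fockWeight q (m + 1) * v m := by
  induction v using Finsupp.induction_linear with
  | zero => simp
  | add v w hv hw => simp only [map_add, Finsupp.add_apply, hv, hw, mul_add]
  | single n c =>
    rw [← mul_one c, ← smul_eq_mul, ← Finsupp.smul_single, map_smul, fockZ_single]
    by_cases h : n = m <;> simp [h, mul_comm]

theorem fockZs_apply (v : ℕ →₀ ℂ) (m : ℕ) : fockZs q v m = fockWeight q (m + 1) * v (m + 1) := by
  induction v using Finsupp.induction_linear with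
  | zero => simp
  | add v w hv hw => simp only [map_add, Finsupp.add_apply, hv, hw, mul_add]
  | single n c =>
    rw [← mul_one c, ← smul_eq_mul, ← Finsupp.smul_single, map_smul]
    rcases n with _ | n
    · simp [fockZs_single_zero]
    · rw [fockZs_single_succ]
      by_cases h : n = m <;> simp [h, mul_comm]

/-- The matrix element `l_{mn}` as a continuous linear functional on `D(U)_q'`. -/
noncomputable def matrixElemCLM (q : Set.Ioo (0 : ℝ) 1) (m n : ℕ) : Distr q →L[ℂ] ℂ where
  toFun := matrixElem q m n
  map_add' f g := by simp only [matrixElem, Distr.coeff_add, add_mul, Finset.sum_add_distrib]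
  map_smul' c f := by
    simp only [matrixElem, Distr.coeff_smul, mul_assoc, Finset.mul_sum, RingHom.id_apply,
      smul_eq_mul]
  cont := by
    have := Distr.continuous_coeff (q := q)
    unfold matrixElem
    fun_prop

theorem matrixElemCLM_mono (m n j k : ℕ) :
    matrixElemCLM q m n (mono q j k) = fock q (z q ^ j * zs q ^ k) (Finsupp.single n 1) m := by
  change matrixElem q m n (mono q j k) = _
  simp only [matrixElem, mono, Distr.coeff_mk, ite_and, ite_mul, one_mul, zero_mul,
    Finset.sum_ite_irrel, Finset.sum_const_zero, Finset.sum_ite_eq', Finset.mem_range]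
  split_ifs with hj hk
  · rfl
  · exact (fock_monomial_eq_zero q j k m n (by omega)).symm
  · exact (fock_monomial_eq_zero q j k m n (by omega)).symm

theorem matrixElemCLM_toDistr (m n : ℕ) (p : Pol q) :
    matrixElemCLM q m n (toDistr q p) = fock q p (Finsupp.single n 1) m := by
  have h : (matrixElemCLM q m n).toLinearMap ∘ₗ toDistr q =
      Finsupp.lapply m ∘ₗ LinearMap.applyₗ (Finsupp.single n 1) ∘ₗ (fock q).toLinearMap :=
    LinearMap.ext_on_range span_monomials fun i => by
      rw [LinearMap.comp_apply, toDistr_monomial]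
      exact matrixElemCLM_mono m n i.1 i.2
  exact LinearMap.congr_fun h p

@[simp] theorem matrixElemCLM_leftZs (m n : ℕ) (f : Distr q) :
    matrixElemCLM q m n (leftZs q f) = fockWeight q (m + 1) * matrixElemCLM q (m + 1) n f := by
  have h : matrixElemCLM q m n ∘L leftZs q = fockWeight q (m + 1) • matrixElemCLM q (m + 1) n :=
    clm_ext_toDistr fun p => by
      simp [← toDistr_zs_mul, matrixElemCLM_toDistr, fockZs_apply]
  exact DFunLike.congr_fun h f

@[simp] theorem matrixElemCLM_rightZ (m n : ℕ) (f : Distr q) :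
    matrixElemCLM q m n (rightZ q f) = fockWeight q (n + 1) * matrixElemCLM q m (n + 1) f := by
  have h : matrixElemCLM q m n ∘L rightZ q = fockWeight q (n + 1) • matrixElemCLM q m (n + 1) :=
    clm_ext_toDistr fun p => by
      simp [← toDistr_mul_z, matrixElemCLM_toDistr, fockZ_single, -Finsupp.smul_single]
  exact DFunLike.congr_fun h f

@[simp] theorem matrixElemCLM_leftZ_zero (n : ℕ) (f : Distr q) :
    matrixElemCLM q 0 n (leftZ q f) = 0 := by
  have h : matrixElemCLM q 0 n ∘L leftZ q = 0 :=
    clm_ext_toDistr fun p => by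
      simp [← toDistr_z_mul, matrixElemCLM_toDistr, fockZ_apply_zero]
  exact DFunLike.congr_fun h f

@[simp] theorem matrixElemCLM_leftZ_succ (m n : ℕ) (f : Distr q) :
    matrixElemCLM q (m + 1) n (leftZ q f) = fockWeight q (m + 1) * matrixElemCLM q m n f := by
  have h : matrixElemCLM q (m + 1) n ∘L leftZ q = fockWeight q (m + 1) • matrixElemCLM q m n :=
    clm_ext_toDistr fun p => by
      simp [← toDistr_z_mul, matrixElemCLM_toDistr, fockZ_apply_succ]
  exact DFunLike.congr_fun h f

@[simp] theorem matrixElemCLM_rightZs_zero (m : ℕ) (f : Distr q) :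
    matrixElemCLM q m 0 (rightZs q f) = 0 := by
  have h : matrixElemCLM q m 0 ∘L rightZs q = 0 :=
    clm_ext_toDistr fun p => by
      simp [← toDistr_mul_zs, matrixElemCLM_toDistr, fockZs_single_zero]
  exact DFunLike.congr_fun h f

@[simp] theorem matrixElemCLM_rightZs_succ (m n : ℕ) (f : Distr q) :
    matrixElemCLM q m (n + 1) (rightZs q f) = fockWeight q (n + 1) * matrixElemCLM q m n f := by
  have h : matrixElemCLM q m (n + 1) ∘L rightZs q = fockWeight q (n + 1) • matrixElemCLM q m n :=
    clm_ext_toDistr fun p => by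
      simp [← toDistr_mul_zs, matrixElemCLM_toDistr, fockZs_single_succ, -Finsupp.smul_single]
  exact DFunLike.congr_fun h f

/-! ### Distributions as matrices -/

theorem matrixElemCLM_zero_zero (f : Distr q) : matrixElemCLM q 0 0 f = f.coeff 0 0 := by
  change matrixElem q 0 0 f = _
  simp [matrixElem]

theorem coeff_eq_zero_of_matrixElemCLM_eq_zero (j k : ℕ) {f : Distr q}
    (hf : ∀ m n, matrixElemCLM q m n f = 0) : f.coeff j k = 0 := by
  induction k generalizing j f with
  | zero =>
    induction j generalizing f with
    | zero => rw [← matrixElemCLM_zero_zero, hf]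
    | succ j ih =>
      have h : (leftZs q f).coeff j 0 = 0 :=
        ih fun m n => by rw [matrixElemCLM_leftZs, hf, mul_zero]
      rw [leftZs_zero] at h
      exact (mul_eq_zero.1 h).resolve_left (one_sub_qc_pow_ne_zero j)
  | succ k ih =>
    have h : (rightZ q f).coeff j k = 0 :=
      ih j fun m n => by rw [matrixElemCLM_rightZ, hf, mul_zero]
    rcases j with _ | j
    · rw [rightZ_zero] at h
      exact (mul_eq_zero.1 h).resolve_left (one_sub_qc_pow_ne_zero k)
    · rw [rightZ_succ, ih j hf, mul_zero, zero_add] at h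
      exact (mul_eq_zero.1 h).resolve_left (one_sub_qc_pow_ne_zero k)

theorem matrixElemCLM_ext {f g : Distr q}
    (h : ∀ m n, matrixElemCLM q m n f = matrixElemCLM q m n g) : f = g :=
  sub_eq_zero.1 <| Distr.ext' fun j k =>
    coeff_eq_zero_of_matrixElemCLM_eq_zero j k fun m n => by rw [map_sub, h, sub_self]

theorem leftZs_pow_eq_zero_iff (N : ℕ) (f : Distr q) :
    (leftZs q ^ N) f = 0 ↔ ∀ m n, matrixElemCLM q (m + N) n f = 0 := by
  induction N generalizing f with
  | zero =>
    rw [pow_zero, one_apply_eq_self]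
    exact ⟨fun h m n => by rw [h, map_zero], fun h => matrixElemCLM_ext (by simpa using h)⟩
  | succ N ih =>
    rw [pow_succ, mul_apply_eq_comp, ih]
    simp only [matrixElemCLM_leftZs, mul_eq_zero, fockWeight_succ_ne_zero, false_or]
    rfl

theorem rightZ_pow_eq_zero_iff (N : ℕ) (f : Distr q) :
    (rightZ q ^ N) f = 0 ↔ ∀ m n, matrixElemCLM q m (n + N) f = 0 := by
  induction N generalizing f with
  | zero =>
    rw [pow_zero, one_apply_eq_self]
    exact ⟨fun h m n => by rw [h, map_zero], fun h => matrixElemCLM_ext (by simpa using h)⟩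
  | succ N ih =>
    rw [pow_succ, mul_apply_eq_comp, ih]
    simp only [matrixElemCLM_rightZ, mul_eq_zero, fockWeight_succ_ne_zero, false_or]
    rfl

theorem mem_finiteFunctions_iff {f : Distr q} :
    f ∈ finiteFunctions q ↔ ∃ N, (∀ m n, matrixElemCLM q (m + N) n f = 0) ∧
      ∀ m n, matrixElemCLM q m (n + N) f = 0 := by
  simp only [← leftZs_pow_eq_zero_iff, ← rightZ_pow_eq_zero_iff]
  rfl

/-! ### Matrix units -/

/-- The coefficients `c_j` of `f₀ = ∑ c_j z^j z*^j`, determined by `z* f₀ = 0` and `c_0 = 1`. -/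
noncomputable def vacuumCoeff (q : Set.Ioo (0 : ℝ) 1) : ℕ → ℂ
  | 0 => 1
  | j + 1 => -(qc q ^ (2 * j) / (1 - qc q ^ (2 * (j + 1)))) * vacuumCoeff q j

theorem vacuumCoeff_recurrence (j : ℕ) :
    qc q ^ (2 * j) * vacuumCoeff q j + (1 - qc q ^ (2 * (j + 1))) * vacuumCoeff q (j + 1) = 0 := by
  have h := one_sub_qc_pow_ne_zero (q := q) j
  rw [vacuumCoeff]
  field_simp
  ring

/-- The distribution `f₀`: its matrix is the projection onto the vacuum vector `e_0`. -/
noncomputable def vacuum (q : Set.Ioo (0 : ℝ) 1) : Distr q :=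
  Distr.mk fun j k => if j = k then vacuumCoeff q j else 0

theorem leftZs_vacuum : leftZs q (vacuum q) = 0 := by
  apply Distr.ext'
  rintro j (_ | k)
  · simp [vacuum]
  · rcases eq_or_ne j k with rfl | h
    · simp [vacuum, vacuumCoeff_recurrence]
    · simp [vacuum, h]

theorem rightZ_vacuum : rightZ q (vacuum q) = 0 := by
  apply Distr.ext'
  rintro (_ | j) k
  · simp [vacuum]
  · rcases eq_or_ne j k with rfl | h
    · simp [vacuum, vacuumCoeff_recurrence]
    · simp [vacuum, h]

theorem matrixElemCLM_vacuum (m n : ℕ) :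
    matrixElemCLM q m n (vacuum q) = if m = 0 ∧ n = 0 then 1 else 0 := by
  rcases m with _ | m
  · rcases n with _ | n
    · simp [matrixElemCLM_zero_zero, vacuum, vacuumCoeff]
    · have h := matrixElemCLM_rightZ 0 n (vacuum q)
      simpa [rightZ_vacuum, fockWeight_succ_ne_zero] using h
  · have h := matrixElemCLM_leftZs m n (vacuum q)
    simpa [leftZs_vacuum, fockWeight_succ_ne_zero] using h

/-- The distribution whose only nonzero matrix element is `l_{mn} = 1`, namely `z^m f₀ z*^n` up to
normalization. -/
noncomputable def matrixUnit (q : Set.Ioo (0 : ℝ) 1) : ℕ → ℕ → Distr q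
  | 0, 0 => vacuum q
  | 0, n + 1 => (fockWeight q (n + 1))⁻¹ • rightZs q (matrixUnit q 0 n)
  | m + 1, n => (fockWeight q (m + 1))⁻¹ • leftZ q (matrixUnit q m n)

@[simp] theorem matrixElemCLM_matrixUnit (j k m n : ℕ) :
    matrixElemCLM q j k (matrixUnit q m n) = if j = m ∧ k = n then 1 else 0 := by
  induction m generalizing j with
  | zero =>
    induction n generalizing k with
    | zero => rw [matrixUnit, matrixElemCLM_vacuum]
    | succ n ih =>
      rcases k with _ | k
      · simp [matrixUnit]
      · by_cases h : k = n <;> simp [matrixUnit, ih, h, fockWeight_succ_ne_zero]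
  | succ m ih =>
    rcases j with _ | j
    · simp [matrixUnit]
    · by_cases h : j = m <;> simp [matrixUnit, ih, h, fockWeight_succ_ne_zero]

theorem leftZ_matrixUnit (m n : ℕ) :
    leftZ q (matrixUnit q m n) = fockWeight q (m + 1) • matrixUnit q (m + 1) n := by
  rw [matrixUnit, smul_inv_smul₀ (fockWeight_succ_ne_zero m)]

theorem rightZs_matrixUnit (m n : ℕ) :
    rightZs q (matrixUnit q m n) = fockWeight q (n + 1) • matrixUnit q m (n + 1) :=
  matrixElemCLM_ext fun j k => by
    rcases k with _ | k
    · simp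
    · by_cases h : k = n <;> simp [h]

theorem leftZs_matrixUnit_zero (n : ℕ) : leftZs q (matrixUnit q 0 n) = 0 :=
  matrixElemCLM_ext fun j k => by simp

theorem leftZs_matrixUnit_succ (m n : ℕ) :
    leftZs q (matrixUnit q (m + 1) n) = fockWeight q (m + 1) • matrixUnit q m n :=
  matrixElemCLM_ext fun j k => by by_cases h : j = m <;> simp [h]

theorem rightZ_matrixUnit_zero (m : ℕ) : rightZ q (matrixUnit q m 0) = 0 :=
  matrixElemCLM_ext fun j k => by simp

theorem mem_span_matrixUnit {f : Distr q} (hf : f ∈ finiteFunctions q) :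
    f ∈ Submodule.span ℂ (Set.range fun i : ℕ × ℕ => matrixUnit q i.1 i.2) := by
  obtain ⟨N, h_row, h_col⟩ := mem_finiteFunctions_iff.1 hf
  have h : f = ∑ i ∈ Finset.range N ×ˢ Finset.range N,
      matrixElemCLM q i.1 i.2 f • matrixUnit q i.1 i.2 := by
    refine matrixElemCLM_ext fun j k => ?_
    simp only [map_sum, map_smul, matrixElemCLM_matrixUnit, smul_eq_mul, ite_and, mul_ite, mul_one,
      mul_zero, Finset.sum_product, Finset.sum_ite_irrel, Finset.sum_const_zero, Finset.sum_ite_eq,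
      Finset.mem_range]
    split_ifs with hj hk
    · rfl
    · obtain ⟨k, rfl⟩ := Nat.exists_eq_add_of_le' (not_lt.1 hk)
      exact h_col j k
    · obtain ⟨j, rfl⟩ := Nat.exists_eq_add_of_le' (not_lt.1 hj)
      exact h_row j k
  rw [h]
  exact Submodule.sum_mem _ fun i _ => Submodule.smul_mem _ _ (Submodule.subset_span ⟨i, rfl⟩)

/-! ### The module generated by `f₀` -/

theorem dE_eq (f : Distr q) :
    dE q f = -(qh q / (1 - qc q ^ 2)) • (leftZ q f - rightZ q (dK q f)) := by
  have hq := qc_ne q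
  have hq_sq := one_sub_ne q
  apply Distr.ext'
  rintro (_ | j) k
  · simp only [dE_zero, qnum, Distr.coeff_smul, Distr.coeff_sub, leftZ_zero, rightZ_zero, coeff_dK]
    field_simp
    ring
  · simp only [dE_succ, qnum, Distr.coeff_smul, Distr.coeff_sub, leftZ_succ, rightZ_succ, coeff_dK]
    field_simp
    ring

theorem dF_eq (f : Distr q) :
    dF q f = (qh q * qc q ^ 2 / (1 - qc q ^ 2)) • (leftZs q (dKinv q f) - rightZs q f) := by
  have hq := qc_ne q
  have hq_sq := one_sub_ne q
  apply Distr.ext'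
  rintro j (_ | k)
  · simp only [dF_zero, qnum, Distr.coeff_smul, Distr.coeff_sub, leftZs_zero, rightZs_zero,
      coeff_dKinv]
    field_simp
    ring
  · simp only [dF_succ, qnum, Distr.coeff_smul, Distr.coeff_sub, leftZs_succ, rightZs_succ,
      coeff_dKinv]
    field_simp
    ring

instance : IsScalarTower ℂ (Uq q) (Distr q) := .of_algebraMap_smul (algebraMap_smul' q)

section

variable {S : Submodule (Uq q) (Distr q)} {f : Distr q}

theorem leftZ_mem (hf : f ∈ S) (hz : rightZ q f = 0) : leftZ q f ∈ S := by
  have hE : dE q f ∈ S := by simpa only [smul_def, act_E] using S.smul_mem (ugen q .E) hf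
  rw [dE_eq, rightZ_dK, hz, map_zero, smul_zero, sub_zero] at hE
  exact (S.smul_mem_iff (neg_ne_zero.2 (div_ne_zero qh_ne_zero (one_sub_ne q)))).1 hE

theorem rightZs_mem (hf : f ∈ S) (hzs : leftZs q f ∈ S) : rightZs q f ∈ S := by
  have hKinv : leftZs q (dKinv q f) ∈ S := by
    rw [leftZs_dKinv, ← act_Kinv, ← smul_def]
    exact S.smul_of_tower_mem _ (S.smul_mem _ hzs)
  have hF : dF q f ∈ S := by simpa only [smul_def, act_F] using S.smul_mem (ugen q .F) hf
  rw [dF_eq, S.smul_mem_iff (div_ne_zero (mul_ne_zero qh_ne_zero (pow_ne_zero 2 (qc_ne q)))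
    (one_sub_ne q))] at hF
  exact (S.sub_mem_iff_right hKinv).1 hF

end

theorem matrixUnit_mem_span_vacuum (m n : ℕ) :
    matrixUnit q m n ∈ Submodule.span (Uq q) {vacuum q} := by
  induction n generalizing m with
  | zero =>
    induction m with
    | zero =>
      rw [matrixUnit]
      exact Submodule.mem_span_singleton_self (vacuum q)
    | succ m ih =>
      have h := leftZ_mem ih (rightZ_matrixUnit_zero m)
      rwa [leftZ_matrixUnit, Submodule.smul_mem_iff _ (fockWeight_succ_ne_zero m)] at h
  | succ n ih =>
    have h_lower : leftZs q (matrixUnit q m n) ∈ Submodule.span (Uq q) {vacuum q} := by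
      rcases m with _ | m
      · rw [leftZs_matrixUnit_zero]
        exact Submodule.zero_mem _
      · rw [leftZs_matrixUnit_succ]
        exact Submodule.smul_of_tower_mem _ _ (ih m)
    have h := rightZs_mem (ih m) h_lower
    rwa [rightZs_matrixUnit, Submodule.smul_mem_iff _ (fockWeight_succ_ne_zero n)] at h

theorem vacuum_mem_finiteFunctions : vacuum q ∈ finiteFunctions q :=
  ⟨1, by rw [pow_one, leftZs_vacuum], by rw [pow_one, rightZ_vacuum]⟩

theorem span_vacuum : Submodule.span (Uq q) {vacuum q} = finiteFunctions q := by
  refine le_antisymm ?_ fun f hf => ?_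
  · rw [Submodule.span_singleton_le_iff_mem]
    exact vacuum_mem_finiteFunctions
  · have h : Submodule.span ℂ (Set.range fun i : ℕ × ℕ => matrixUnit q i.1 i.2) ≤
        (Submodule.span (Uq q) {vacuum q}).restrictScalars ℂ :=
      Submodule.span_le.2 (Set.range_subset_iff.2 fun i => matrixUnit_mem_span_vacuum i.1 i.2)
    exact h (mem_span_matrixUnit hf)

end QDisc

theorem theorem3p9 (q : Set.Ioo (0 : ℝ) 1) :
    ∃ f₀ : QDisc.Distr q,
      (∀ f : QDisc.Distr q,
        (f ∈ QDisc.finiteFunctions q ∧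
          ∀ m n : ℕ, QDisc.matrixElem q m n f = if m = 0 ∧ n = 0 then 1 else 0) ↔ f = f₀) ∧
      Submodule.span (QDisc.Uq q) {f₀} = QDisc.finiteFunctions q := by
  refine ⟨QDisc.vacuum q, fun f => ⟨fun ⟨_, hf⟩ => ?_, ?_⟩, QDisc.span_vacuum⟩
  · exact QDisc.matrixElemCLM_ext fun m n => (hf m n).trans (QDisc.matrixElemCLM_vacuum m n).symm
  · rintro rfl
    exact ⟨QDisc.vacuum_mem_finiteFunctions, QDisc.matrixElemCLM_vacuum⟩
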